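/- Let $p(x,y)=1+2y-3x^2$ and $q(x,y)=24x^3-y^2-12xy-6x-4y-1$, and let $\triangle^*=\{(x,y)\in\mathbb R^2:\ p(x,y)\ge 0,\ q(x,y)\ge 0\}$ be the compact curvilinear triangle bounded by the curves $p=0$ and $q=0$. For real $\alpha,\beta$ put $$w_{\alpha,\beta}=\frac{(4\pi^2)^{\alpha+\beta}}{3^{2\alpha+\beta}}\,p^{\alpha}q^{\beta},\qquad \langle f,g\rangle_{w_{\alpha,\beta}}=c_{\alpha,\beta}\int_{\triangle^*}f(x,y)\,\overline{g(x,y)}\,w_{\alpha,\beta}(x,y)\,dx\,dy,$$ where $c_{\alpha,\beta}=1/\int_{\triangle^*}w_{\alpha,\beta}\,dx\,dy$ if $w_{\alpha,\beta}$ is integrable on $\triangle^*$, and $c_{\alpha,\beta}=1$ otherwise. Let $$A_{11}=-6x^2+y+3x+2,\quad A_{12}=A_{21}=-9xy+18x^2-6y-3,\quad A_{22}=-18y^2+108x^3-54xy-27x-9y,$$ $\Lambda=\begin{pmatrix}A_{11}&A_{12}\\A_{21}&A_{22}\end{pmatrix}$, $\nabla=(\partial_x,\partial_y)^{\mathsf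 T}$, and $$\mathcal L_{\alpha,\beta}f=-w_{-\alpha,-\beta}\,\nabla^{\mathsf T}\big(w_{\alpha,\beta}\Lambda\nabla f\big).$$ Let $\mathcal D_{\alpha,\beta}$ be the set of complex-valued functions $f$ that are twice continuously differentiable in a neighbourhood of $\triangle^*$ and for which $|f|^2w_{\alpha,\beta}$ and $|\mathcal L_{\alpha,\beta}f|^2w_{\alpha,\beta}$ are integrable over $\triangle^*$. **Theorem.** Let $\alpha,\beta>-1$. 1. If $w_{\alpha,\beta}$ is integrable on $\triangle^*$, then $\mathcal D_{\alpha,\beta}$ contains every function that is $C^2$ in a neighbourhood of $\triangle^*$. 2. $\mathcal L_{\alpha,\beta}$ is self-adjoint with respect to $\langle\cdot,\cdot\rangle_{w_{\alpha,\beta}}$: for all $f,g\in\mathcal D_{\alpha,\beta}$ the integrals defining $\langle\mathcal L_{\alpha,\beta}f,g\rangle_{w_{\alpha,\beta}}$ and $\langle f,\mathcal L_{\alpha,\beta}g\rangle_{w_{\alpha,\beta}}$ converge absolutely, and $\langle\mathcal L_{\alpha,\beta}f,g\rangle_{w_{\alpha,\beta}}=\langle f,\mathcal L_{\alpha,\beta}g\rangle_{w_{\alpha,\beta}}$.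 3. $\mathcal L_{\alpha,\beta}$ is positive definite up to constants: for every $f\in\mathcal D_{\alpha,\beta}$ the number $\langle\mathcal L_{\alpha,\beta}f,f\rangle_{w_{\alpha,\beta}}$ is real and nonnegative, and it is $0$ if and only if $f$ is constant on $\triangle^*$. -/

import Mathlib

open MeasureTheory ComplexConjugate

noncomputable section

namespace GTwoJacobi

/-- The polynomial `1 + 2y - 3x²`, vanishing on the first boundary curve. -/
def p (z : ℝ × ℝ) : ℝ := 1 + 2 * z.2 - 3 * z.1 ^ 2

/-- The polynomial `24x³ - y² - 12xy - 6x - 4y - 1`, vanishing on the second boundary curve. -/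
def q (z : ℝ × ℝ) : ℝ :=
  24 * z.1 ^ 3 - z.2 ^ 2 - 12 * z.1 * z.2 - 6 * z.1 - 4 * z.2 - 1

/-- The compact curvilinear triangle `△*` bounded by the two curves `p = 0` and `q = 0`;
both polynomials are nonnegative on it. -/
def region : Set (ℝ × ℝ) := {z | 0 ≤ p z ∧ 0 ≤ q z}

/-- The weight `w_{α,β} = (4π²)^{α+β} / 3^{2α+β} · p^α · q^β` (a real power; used on `△*` only). -/
def weight (α β : ℝ) (z : ℝ × ℝ) : ℝ :=
  (4 * Real.pi ^ 2) ^ (α + β) / 3 ^ (2 * α + β) * p z ^ α * q z ^ β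

open Classical in
/-- The normalization constant `c_{α,β} = 1 / ∫_{△*} w_{α,β}`. If the weight has infinite mass on
`△*`, no normalization is possible and the constant is taken to be `1`. -/
def normConst (α β : ℝ) : ℝ :=
  if IntegrableOn (weight α β) region then 1 / ∫ z in region, weight α β z else 1

/-- The pairing `⟨f, g⟩ = c_{α,β} ∫_{△*} f(x,y) conj(g(x,y)) w_{α,β}(x,y) dx dy`. -/
def innerW (α β : ℝ) (f g : ℝ × ℝ → ℂ) : ℂ :=
  (normConst α β : ℂ) * ∫ z in region, f z * conj (g z) * (weight α β z : ℂ)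

/-- The coefficient `A₁₁` of the matrix `Λ`. -/
def A₁₁ (z : ℝ × ℝ) : ℝ := -6 * z.1 ^ 2 + z.2 + 3 * z.1 + 2

/-- The coefficient `A₁₂ = A₂₁` of `Λ`. -/
def A₁₂ (z : ℝ × ℝ) : ℝ := -9 * z.1 * z.2 + 18 * z.1 ^ 2 - 6 * z.2 - 3

/-- The coefficient `A₂₂` of `Λ`, of degree 3. -/
def A₂₂ (z : ℝ × ℝ) : ℝ :=
  -18 * z.2 ^ 2 + 108 * z.1 ^ 3 - 54 * z.1 * z.2 - 27 * z.1 - 9 * z.2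

/-- The partial derivative `∂ₓ`. -/
def dx (f : ℝ × ℝ → ℂ) (z : ℝ × ℝ) : ℂ := fderiv ℝ f z (1, 0)

/-- The partial derivative `∂_y`. -/
def dy (f : ℝ × ℝ → ℂ) (z : ℝ × ℝ) : ℂ := fderiv ℝ f z (0, 1)

/-- The operator `L_{α,β} f = -w_{-α,-β} [∂ₓ(w_{α,β}(A₁₁ ∂ₓf + A₁₂ ∂_y f))
+ ∂_y(w_{α,β}(A₂₁ ∂ₓf + A₂₂ ∂_y f))]`, that is `-w_{-α,-β} ∇ᵀ w_{α,β} Λ ∇ f`.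
Its values matter in the interior of `△*` only, where the weight is smooth and positive. -/
def L (α β : ℝ) (f : ℝ × ℝ → ℂ) (z : ℝ × ℝ) : ℂ :=
  -(weight (-α) (-β) z : ℂ) *
    (dx (fun u => (weight α β u : ℂ) * ((A₁₁ u : ℂ) * dx f u + (A₁₂ u : ℂ) * dy f u)) z +
     dy (fun u => (weight α β u : ℂ) * ((A₁₂ u : ℂ) * dx f u + (A₂₂ u : ℂ) * dy f u)) z)

/-- Functions that are twice continuously differentiable in a neighbourhood of `△*`. -/
def IsC2 (f : ℝ × ℝ → ℂ) : Prop := ∀ z ∈ region, ContDiffAt ℝ 2 f z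

/-- Square integrability over `△*` with respect to the weight `w_{α,β}`. -/
def SqIntegrable (α β : ℝ) (f : ℝ × ℝ → ℂ) : Prop :=
  IntegrableOn (fun z => ‖f z‖ ^ 2 * weight α β z) region

/-- The natural domain of `L_{α,β}` on functions that are `C²` up to the boundary:
both `f` and `L_{α,β} f` are square integrable. -/
structure InDomain (α β : ℝ) (f : ℝ × ℝ → ℂ) : Prop where
  isC2 : IsC2 f
  sqIntegrable : SqIntegrable α β f
  sqIntegrable_L : SqIntegrable α β (L α β f)

end GTwoJacobi

end

open GTwoJacobi

noncomputable section

namespace GTwoJacobi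

open Set Topology Filter Asymptotics
open scoped ENNReal

/-! Both boundary curves are characteristic for Λ: Λ∇p is divisible by p and Λ∇q by q (`flux_p`,
`flux_q`). So the singular factors 1/p and 1/q in ∇w cancel, and on the open triangle L f equals a
differential operator with polynomial coefficients (`L_eq`); in particular L f is bounded for every
C² function f. The same divisibility lets one integrate by parts without boundary terms: for a
cutoff χ_n built from (n+1)p and (n+1)q, the quantity ∇χ_n · Λ∇f is bounded uniformly in n and tends
to 0 pointwise. Dominated convergence then gives the Green formula `tendsto_dirichlet`, in which ∫ L
f · conj g · w is the limit of truncated Dirichlet integrals.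

Symmetry follows because Λ is real symmetric. Positivity follows from det Λ = 9pq together with A₁₁
> 0 on the open triangle. If the form vanishes, Fatou gives ∇f = 0 almost everywhere, and
connectedness makes f constant.

The analytic difficulty is that w may have infinite mass when α, β > -1, owing to the cusp (-1/2, 1)
and the horn (1, 1). Dominated convergence needs only that w·g is integrable. Where w is not locally
integrable, square integrability forces g, and also L g, to vanish. At the horn Λ is zero, so L g
there is a multiple of the derivative along the axis of the horn. The resulting order of vanishing
compensates for the weight (`InDomain.integrableOn_weight_mul`). -/

/-! ### Geometry of the curvilinear triangle. -/

/-- The open curvilinear triangle. -/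
def interiorRegion : Set (ℝ × ℝ) := {z | 0 < p z ∧ 0 < q z}

lemma continuous_p : Continuous p := by unfold p; fun_prop

lemma continuous_q : Continuous q := by unfold q; fun_prop

lemma isOpen_interiorRegion : IsOpen interiorRegion :=
  (isOpen_lt continuous_const continuous_p).inter (isOpen_lt continuous_const continuous_q)

lemma isClosed_region : IsClosed region :=
  (isClosed_le continuous_const continuous_p).inter (isClosed_le continuous_const continuous_q)

lemma interiorRegion_subset : interiorRegion ⊆ region := fun _ hz => ⟨hz.1.le, hz.2.le⟩

/-- Upper boundary of the triangle over `x = (3t² - 1)/2`. -/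
def upper (t : ℝ) : ℝ := 1 - 9 * t ^ 2 + 9 * t ^ 3

/-- Lower branch of `q = 0` over `x = (3t² - 1)/2`. -/
def lowerQ (t : ℝ) : ℝ := 1 - 9 * t ^ 2 - 9 * t ^ 3

/-- The curve `p = 0` over `x = (3t² - 1)/2`. -/
def lowerP (t : ℝ) : ℝ := upper t - 9 / 8 * (1 - t) ^ 3 * (3 * t + 1)

lemma p_param (t y : ℝ) : p ((3 * t ^ 2 - 1) / 2, y) = 2 * (y - lowerP t) := by
  simp only [p, lowerP, upper]; ring

/-- The substitution 2x + 1 = 3t² turns the cubic term 3(2x + 1)³ of `q_eq` into the square (9t³)²,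
so q is a difference of squares. The cusp is t = 0, the horn t = 1, and the third corner (-1/3,
-1/3) is t = 1/3, where the two lower curves cross. -/
lemma q_param (t y : ℝ) : q ((3 * t ^ 2 - 1) / 2, y) = (upper t - y) * (y - lowerQ t) := by
  simp only [q, upper, lowerQ]; ring

lemma q_eq (z : ℝ × ℝ) : q z = 3 * (2 * z.1 + 1) ^ 3 - (z.2 + 6 * z.1 + 2) ^ 2 := by
  simp only [q]; ring

/-- The triangle lies between its lower and upper boundary curves. -/
lemma exists_param_of_mem_region {z : ℝ × ℝ} (hz : z ∈ region) :
    ∃ t ∈ Icc (0 : ℝ) 1, z.1 = (3 * t ^ 2 - 1) / 2 ∧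
      max (lowerQ t) (lowerP t) ≤ z.2 ∧ z.2 ≤ upper t := by
  obtain ⟨x, y⟩ := z
  obtain ⟨hp, hq⟩ := hz
  have hx : 0 ≤ 2 * x + 1 := by
    by_contra! h
    rw [q_eq] at hq
    have : (2 * x + 1) ^ 3 < 0 := by
      have : 0 < (-(2 * x + 1)) ^ 3 := by apply pow_pos; linarith
      nlinarith
    nlinarith [sq_nonneg (y + 6 * x + 2)]
  have ht0 := Real.sqrt_nonneg ((2 * x + 1) / 3)
  have hts : Real.sqrt ((2 * x + 1) / 3) ^ 2 = (2 * x + 1) / 3 := Real.sq_sqrt (by positivity)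
  set t := Real.sqrt ((2 * x + 1) / 3)
  have hxt : x = (3 * t ^ 2 - 1) / 2 := by rw [hts]; ring
  rw [hxt, p_param] at hp
  rw [hxt, q_param] at hq
  have h3 : 0 ≤ t ^ 3 := by positivity
  have hul : upper t - lowerQ t = 18 * t ^ 3 := by simp only [upper, lowerQ]; ring
  have hup : y ≤ upper t := by
    by_contra! h
    nlinarith
  have hlo : lowerQ t ≤ y := by
    by_contra! h
    nlinarith
  have hlp : lowerP t ≤ y := by linarith
  -- Beyond t = 1 the parabola p = 0 lies above the upper branch, so the fibre is empty.
  have ht1 : t ≤ 1 := by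
    by_contra! h
    have h1 : 0 < (t - 1) ^ 3 * (3 * t + 1) := by
      have : 0 < t - 1 := by linarith
      positivity
    have : upper t - lowerP t = -(9 / 8 * ((t - 1) ^ 3 * (3 * t + 1))) := by
      simp only [lowerP]; ring
    linarith
  exact ⟨t, ⟨ht0, ht1⟩, hxt, max_le hlo hlp, hup⟩

lemma lower_le_upper {t : ℝ} (ht : t ∈ Icc (0 : ℝ) 1) :
    max (lowerQ t) (lowerP t) ≤ upper t := by
  obtain ⟨h0, h1⟩ := ht
  apply max_le
  · have : 0 ≤ t ^ 3 := by positivity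
    simp only [upper, lowerQ]; linarith
  · have h : 0 ≤ 1 - t := by linarith
    have : 0 ≤ 9 / 8 * (1 - t) ^ 3 * (3 * t + 1) := by positivity
    simp only [lowerP]; linarith

lemma lower_lt_upper {t : ℝ} (ht : t ∈ Ioo (0 : ℝ) 1) :
    max (lowerQ t) (lowerP t) < upper t := by
  obtain ⟨h0, h1⟩ := ht
  apply max_lt
  · have : 0 < t ^ 3 := by positivity
    simp only [upper, lowerQ]; linarith
  · have h : 0 < 1 - t := by linarith
    have : 0 < 9 / 8 * (1 - t) ^ 3 * (3 * t + 1) := by positivity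
    simp only [lowerP]; linarith

/-- Parametrization of the triangle by a square. -/
def paramMap (s : ℝ × ℝ) : ℝ × ℝ :=
  ((3 * s.1 ^ 2 - 1) / 2,
    (1 - s.2) * max (lowerQ s.1) (lowerP s.1) + s.2 * upper s.1)

lemma continuous_paramMap : Continuous paramMap := by
  unfold paramMap lowerQ lowerP upper; fun_prop

/-- Each vertical fibre is a segment, so the triangle inherits compactness from the square. With the
analogous description of the open triangle, connectedness and density of the interior transfer as
well. -/
lemma region_eq_image : region = paramMap '' (Icc 0 1 ×ˢ Icc 0 1) := by
  ext z
  constructor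
  · intro hz
    obtain ⟨t, ht, hx, hl, hu⟩ := exists_param_of_mem_region hz
    obtain ⟨a, b, ha, hb, hab, h⟩ : z.2 ∈ segment ℝ (max (lowerQ t) (lowerP t)) (upper t) := by
      rw [segment_eq_Icc (lower_le_upper ht)]; exact ⟨hl, hu⟩
    refine ⟨(t, b), ⟨ht, hb, by linarith⟩, ?_⟩
    ext
    · exact hx.symm
    · rw [← h, show a = 1 - b by linarith]; simp [paramMap]
  · rintro ⟨⟨t, b⟩, ⟨ht, hb⟩, rfl⟩
    simp only at ht hb
    have hm : (1 - b) * max (lowerQ t) (lowerP t) + b * upper t ∈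
        Icc (max (lowerQ t) (lowerP t)) (upper t) := by
      have := lower_le_upper ht
      constructor <;> nlinarith [hb.1, hb.2]
    have h1 := (le_max_left _ _).trans hm.1
    have h2 := (le_max_right _ _).trans hm.1
    refine ⟨?_, ?_⟩
    · simp only [paramMap]; rw [p_param]; linarith
    · simp only [paramMap]; rw [q_param]
      exact mul_nonneg (by linarith [hm.2]) (by linarith)

lemma exists_param_of_mem_interior {z : ℝ × ℝ} (hz : z ∈ interiorRegion) :
    ∃ t ∈ Ioo (0 : ℝ) 1, z.1 = (3 * t ^ 2 - 1) / 2 ∧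
      max (lowerQ t) (lowerP t) < z.2 ∧ z.2 < upper t := by
  obtain ⟨t, ht, hx, hl, hu⟩ := exists_param_of_mem_region (interiorRegion_subset hz)
  obtain ⟨x, y⟩ := z
  obtain ⟨hp, hq⟩ := hz
  simp only at hx hl hu
  rw [hx, p_param] at hp
  rw [hx, q_param] at hq
  have h1 := (le_max_left _ _).trans hl
  have hne1 : y ≠ upper t := by rintro rfl; simp at hq
  have hne2 : lowerQ t ≠ y := by rintro rfl; simp at hq
  have hu' := lt_of_le_of_ne hu hne1
  have hl' := lt_of_le_of_ne h1 hne2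
  have hp' : lowerP t < y := by linarith
  refine ⟨t, ⟨lt_of_le_of_ne ht.1 ?_, lt_of_le_of_ne ht.2 ?_⟩, hx, max_lt hl' hp', hu'⟩
  · rintro rfl
    simp only [upper, lowerQ] at hu' hl'; linarith
  · rintro rfl
    simp only [upper, lowerP] at hu' hp'; linarith

lemma interiorRegion_eq_image : interiorRegion = paramMap '' (Ioo 0 1 ×ˢ Ioo 0 1) := by
  ext z
  constructor
  · intro hz
    obtain ⟨t, ht, hx, hl, hu⟩ := exists_param_of_mem_interior hz
    obtain ⟨a, b, ha, hb, hab, h⟩ :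
        z.2 ∈ openSegment ℝ (max (lowerQ t) (lowerP t)) (upper t) := by
      rw [openSegment_eq_Ioo (lower_lt_upper ht)]; exact ⟨hl, hu⟩
    refine ⟨(t, b), ⟨ht, hb, by linarith⟩, ?_⟩
    ext
    · exact hx.symm
    · rw [← h, show a = 1 - b by linarith]; simp [paramMap]
  · rintro ⟨⟨t, b⟩, ⟨ht, hb⟩, rfl⟩
    simp only at ht hb
    have hm : (1 - b) * max (lowerQ t) (lowerP t) + b * upper t ∈
        Ioo (max (lowerQ t) (lowerP t)) (upper t) := by
      have := lower_lt_upper ht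
      constructor <;> nlinarith [hb.1, hb.2]
    have h1 := (le_max_left _ _).trans_lt hm.1
    have h2 := (le_max_right _ _).trans_lt hm.1
    refine ⟨?_, ?_⟩
    · simp only [paramMap]; rw [p_param]; linarith
    · simp only [paramMap]; rw [q_param]
      exact mul_pos (by linarith [hm.2]) (by linarith)

lemma isCompact_region : IsCompact region := by
  rw [region_eq_image]
  exact (isCompact_Icc.prod isCompact_Icc).image continuous_paramMap

lemma isPreconnected_interiorRegion : IsPreconnected interiorRegion := by
  rw [interiorRegion_eq_image]
  exact (isPreconnected_Ioo.prod isPreconnected_Ioo).image _ continuous_paramMap.continuousOn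

lemma region_subset_closure : region ⊆ closure interiorRegion := by
  rw [region_eq_image, interiorRegion_eq_image]
  have : (Icc (0 : ℝ) 1 ×ˢ Icc (0 : ℝ) 1) = closure (Ioo (0 : ℝ) 1 ×ˢ Ioo (0 : ℝ) 1) := by
    rw [closure_prod_eq, closure_Ioo (by norm_num)]
  rw [this]
  exact image_closure_subset_closure_image continuous_paramMap

lemma interiorRegion_nonempty : interiorRegion.Nonempty :=
  ⟨(0, -3 / 8), by norm_num [interiorRegion, p, q]⟩

lemma volume_p_eq_zero : volume {z : ℝ × ℝ | p z = 0} = 0 := by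
  have hm : MeasurableSet {z : ℝ × ℝ | p z = 0} :=
    (isClosed_eq continuous_p continuous_const).measurableSet
  rw [Measure.volume_eq_prod, Measure.measure_prod_null hm]
  refine Eventually.of_forall fun x => ?_
  refine measure_mono_null (t := {(3 * x ^ 2 - 1) / 2}) ?_ (measure_singleton _)
  intro y hy
  simp only [mem_preimage, mem_ofPred_eq, p] at hy
  simp only [mem_singleton_iff]; linarith

lemma volume_q_eq_zero : volume {z : ℝ × ℝ | q z = 0} = 0 := by
  have hm : MeasurableSet {z : ℝ × ℝ | q z = 0} :=
    (isClosed_eq continuous_q continuous_const).measurableSet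
  rw [Measure.volume_eq_prod, Measure.measure_prod_null hm]
  refine Eventually.of_forall fun x => ?_
  refine measure_mono_null (t := {-(6 * x + 2) + √(3 * (2 * x + 1) ^ 3),
    -(6 * x + 2) - √(3 * (2 * x + 1) ^ 3)}) ?_ ((Set.toFinite _).measure_zero _)
  intro y hy
  simp only [mem_preimage, mem_ofPred_eq] at hy
  rw [q_eq] at hy
  simp only at hy
  have h : (y + 6 * x + 2) ^ 2 = √(3 * (2 * x + 1) ^ 3) ^ 2 := by
    rw [Real.sq_sqrt] <;> nlinarith [sq_nonneg (y + 6 * x + 2)]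
  rcases sq_eq_sq_iff_eq_or_eq_neg.1 h with h | h
  · left; linarith
  · right; simp only [mem_singleton_iff]; linarith

lemma volume_boundary : volume (region \ interiorRegion) = 0 := by
  refine measure_mono_null (t := {z | p z = 0} ∪ {z | q z = 0}) ?_
    (measure_union_null volume_p_eq_zero volume_q_eq_zero)
  rintro z ⟨⟨h1, h2⟩, h3⟩
  by_contra h
  simp only [mem_union, mem_ofPred_eq, not_or] at h
  exact h3 ⟨lt_of_le_of_ne h1 (Ne.symm h.1), lt_of_le_of_ne h2 (Ne.symm h.2)⟩

lemma interiorRegion_ae_eq : interiorRegion =ᵐ[volume] region :=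
  (ae_eq_set).2 ⟨by simp [sdiff_eq_empty.2 interiorRegion_subset], volume_boundary⟩

/-- The boundary is null, so identities for the weight and for `L` need checking only where p and q
are positive. -/
lemma restrict_interiorRegion :
    (volume.restrict interiorRegion : Measure (ℝ × ℝ)) = volume.restrict region :=
  Measure.restrict_congr_set interiorRegion_ae_eq

/-- Near the cusp `(-1/2, 1)` the triangle lies in a cone. -/
lemma norm_sub_cusp_le {z : ℝ × ℝ} (hz : z ∈ region) :
    ‖z - (-1 / 2, 1)‖ ≤ 6 * (2 * z.1 + 1) := by
  obtain ⟨t, ⟨h0, h1⟩, hx, hl, hu⟩ := exists_param_of_mem_region hz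
  have hl := (le_max_left _ _).trans hl
  simp only [lowerQ, upper] at hl hu
  have h3 : t ^ 3 ≤ t ^ 2 := pow_le_pow_of_le_one h0 h1 (by norm_num)
  rw [Prod.norm_def]
  simp only [Prod.fst_sub, Prod.snd_sub, Real.norm_eq_abs, hx]
  have := sq_nonneg t
  apply max_le <;> rw [abs_le] <;> constructor <;> nlinarith

/-- Near the vertex `(1, 1)` the triangle is a thin horn with axis of direction `(1, 3)`. -/
lemma abs_sub_tangent_le {z : ℝ × ℝ} (hz : z ∈ region) :
    |z.2 - 1 - 3 * (z.1 - 1)| ≤ 3 * (1 - z.1) ^ 2 := by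
  obtain ⟨t, ⟨h0, h1⟩, hx, hl, hu⟩ := exists_param_of_mem_region hz
  have hl := (le_max_right _ _).trans hl
  simp only [lowerP, upper] at hl hu
  rw [abs_le, hx]
  have h2 : 0 ≤ (1 - t) ^ 2 := sq_nonneg _
  have e1 : 3 * (1 - (3 * t ^ 2 - 1) / 2) ^ 2 = 27 / 4 * (1 + t) ^ 2 * (1 - t) ^ 2 := by ring
  rw [e1]
  constructor
  · have : 1 - 9 * t ^ 2 + 9 * t ^ 3 - 9 / 8 * (1 - t) ^ 3 * (3 * t + 1) - 1 -
        3 * ((3 * t ^ 2 - 1) / 2 - 1) = 27 / 8 * (1 + t) ^ 2 * (1 - t) ^ 2 := by ring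
    have : 0 ≤ (1 + t) ^ 2 * (1 - t) ^ 2 := by positivity
    linarith
  · have : 1 - 9 * t ^ 2 + 9 * t ^ 3 - 1 - 3 * ((3 * t ^ 2 - 1) / 2 - 1) =
        (9 / 2 + 9 * t) * (1 - t) ^ 2 := by ring
    have h4 : (9 / 2 + 9 * t) * (1 - t) ^ 2 ≤ 27 / 4 * (1 + t) ^ 2 * (1 - t) ^ 2 := by
      apply mul_le_mul_of_nonneg_right _ h2
      nlinarith
    linarith

lemma fst_mem_of_mem_region {z : ℝ × ℝ} (hz : z ∈ region) : z.1 ∈ Icc (-1 / 2 : ℝ) 1 := by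
  obtain ⟨t, ⟨h0, h1⟩, hx, -, -⟩ := exists_param_of_mem_region hz
  rw [hx]; constructor <;> nlinarith

lemma norm_sub_horn_le {z : ℝ × ℝ} (hz : z ∈ region) : ‖z - (1, 1)‖ ≤ 8 * (1 - z.1) := by
  have h1 := abs_sub_tangent_le hz
  have h2 := fst_mem_of_mem_region hz
  rw [abs_le] at h1
  rw [Prod.norm_def]
  simp only [Prod.fst_sub, Prod.snd_sub, Real.norm_eq_abs]
  -- Here 1 - x ≤ 3/2, so 3(1 - x) ≤ 9/2.
  have h3 : 3 * (1 - z.1) ^ 2 ≤ 5 * (1 - z.1) := by nlinarith [h2.1, h2.2]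
  apply max_le <;> rw [abs_le] <;> constructor <;> linarith [h2.2]

lemma eq_cusp_of_fst {z : ℝ × ℝ} (hz : z ∈ region) (h : 2 * z.1 + 1 = 0) :
    z = (-1 / 2, 1) := by
  have := norm_sub_cusp_le hz
  rw [h, mul_zero, norm_le_zero_iff, sub_eq_zero] at this
  exact this

lemma eq_horn_of_fst {z : ℝ × ℝ} (hz : z ∈ region) (h : 1 - z.1 = 0) : z = (1, 1) := by
  have := norm_sub_horn_le hz
  rw [h, mul_zero, norm_le_zero_iff, sub_eq_zero] at this
  exact this

/-! ### Positivity of Λ in the open triangle. -/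

lemma det_eq (z : ℝ × ℝ) : A₁₁ z * A₂₂ z - A₁₂ z ^ 2 = 9 * p z * q z := by
  simp only [A₁₁, A₁₂, A₂₂, p, q]; ring

/-- For fixed x the coefficient increases with y, so it suffices that it is nonnegative on the lower
boundary. There it factors as 9/2·t²(1 - 3t)(1 + t) for t ≤ 1/3 and as 27/8·(1 - t²)(3t - 1)(3t + 1)
for t ≥ 1/3. -/
lemma A₁₁_pos {z : ℝ × ℝ} (hz : z ∈ interiorRegion) : 0 < A₁₁ z := by
  obtain ⟨t, ⟨h0, h1⟩, hx, hl, -⟩ := exists_param_of_mem_interior hz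
  have hq := (le_max_left _ _).trans_lt hl
  have hp := (le_max_right _ _).trans_lt hl
  simp only [A₁₁, hx]
  rcases le_total t (1 / 3) with h | h
  · simp only [lowerQ] at hq
    have : 0 ≤ 9 / 2 * t ^ 2 * (1 - 3 * t) * (1 + t) := by
      have : 0 ≤ 1 - 3 * t := by linarith
      positivity
    nlinarith
  · simp only [lowerP, upper] at hp
    have : 0 ≤ 27 / 8 * (1 - t ^ 2) * (3 * t - 1) * (3 * t + 1) := by
      have h3 : 0 ≤ 3 * t - 1 := by linarith
      have : 0 ≤ 1 - t ^ 2 := by nlinarith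
      positivity
    nlinarith

/-! ### Integrability of the weight after damping at the cusp and the horn. -/

/-- The integral of a Jacobi weight over an interval, up to a constant. -/
lemma exists_lintegral_jacobi_le {γ δ : ℝ} (hγ : -1 < γ) (hδ : -1 < δ) :
    ∃ K : ℝ, 0 ≤ K ∧ ∀ a b : ℝ, a < b →
      ∫⁻ y in Ioo a b, ENNReal.ofReal ((y - a) ^ γ * (b - y) ^ δ) ≤
        ENNReal.ofReal (K * (b - a) ^ (γ + δ + 1)) := by
  -- On the half of the interval away from an endpoint, the distance to that endpoint is comparable
  -- to the full length, whatever the sign of the exponent.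
  have key : ∀ {D s e : ℝ}, 0 < D → D / 2 ≤ s → s ≤ D →
      s ^ e ≤ (1 + (1 / 2) ^ e) * D ^ e := by
    intro D s e hD h1 h2
    have hDe : 0 < D ^ e := Real.rpow_pos_of_pos hD e
    have h2e : (0 : ℝ) < (1 / 2) ^ e := by positivity
    rcases le_total 0 e with he | he
    · have := Real.rpow_le_rpow (by linarith) h2 he
      nlinarith
    · have := Real.rpow_le_rpow_of_nonpos (by linarith) h1 he
      rw [show D / 2 = 1 / 2 * D by ring, Real.mul_rpow (by norm_num) hD.le] at this
      nlinarith
  set Cγ : ℝ := 1 + (1 / 2) ^ γ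
  set Cδ : ℝ := 1 + (1 / 2) ^ δ
  have hCγ : 0 ≤ Cγ := by positivity
  have hCδ : 0 ≤ Cδ := by positivity
  refine ⟨Cδ / (γ + 1) + Cγ / (δ + 1), ?_, fun a b hab => ?_⟩
  · have : 0 < γ + 1 := by linarith
    have : 0 < δ + 1 := by linarith
    positivity
  have hD : 0 < b - a := sub_pos.2 hab
  have iγ : IntervalIntegrable (fun y => (y - a) ^ γ) volume a b := by
    have := (intervalIntegral.intervalIntegrable_rpow' (a := 0) (b := b - a) hγ).comp_sub_right a
    simpa using this
  have iδ : IntervalIntegrable (fun y => (b - y) ^ δ) volume a b := by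
    have := (intervalIntegral.intervalIntegrable_rpow' (a := b - a) (b := 0) hδ).comp_sub_left b
    simpa using this
  have vγ : ∫ y in a..b, (y - a) ^ γ = (b - a) ^ (γ + 1) / (γ + 1) := by
    rw [intervalIntegral.integral_comp_sub_right (fun y => y ^ γ), sub_self,
      integral_rpow (Or.inl hγ), Real.zero_rpow (by linarith), sub_zero]
  have vδ : ∫ y in a..b, (b - y) ^ δ = (b - a) ^ (δ + 1) / (δ + 1) := by
    rw [intervalIntegral.integral_comp_sub_left (fun y => y ^ δ), sub_self,
      integral_rpow (Or.inl hδ), Real.zero_rpow (by linarith), sub_zero]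
  have hI : IntegrableOn (fun y => Cδ * (b - a) ^ δ * (y - a) ^ γ +
      Cγ * (b - a) ^ γ * (b - y) ^ δ) (Ioo a b) :=
    ((intervalIntegrable_iff_integrableOn_Ioo_of_le hab.le).1
      ((iγ.const_mul _).add (iδ.const_mul _)))
  calc ∫⁻ y in Ioo a b, ENNReal.ofReal ((y - a) ^ γ * (b - y) ^ δ)
      ≤ ∫⁻ y in Ioo a b, ENNReal.ofReal (Cδ * (b - a) ^ δ * (y - a) ^ γ +
          Cγ * (b - a) ^ γ * (b - y) ^ δ) := by
        refine setLIntegral_mono' measurableSet_Ioo fun y hy => ENNReal.ofReal_le_ofReal ?_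
        have h1 : 0 < y - a := sub_pos.2 hy.1
        have h2 : 0 < b - y := sub_pos.2 hy.2
        have p1 := Real.rpow_pos_of_pos h1 γ
        have p2 := Real.rpow_pos_of_pos h2 δ
        have p3 := Real.rpow_pos_of_pos hD γ
        have p4 := Real.rpow_pos_of_pos hD δ
        rcases le_total (y - a) (b - y) with h | h
        · have := key (e := δ) hD (by linarith : (b - a) / 2 ≤ b - y) (by linarith)
          have h5 : 0 ≤ Cγ * (b - a) ^ γ * (b - y) ^ δ := by positivity
          nlinarith [mul_le_mul_of_nonneg_left this p1.le]
        · have := key (e := γ) hD (by linarith : (b - a) / 2 ≤ y - a) (by linarith)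
          have h5 : 0 ≤ Cδ * (b - a) ^ δ * (y - a) ^ γ := by positivity
          nlinarith [mul_le_mul_of_nonneg_right this p2.le]
    _ = ENNReal.ofReal (∫ y in Ioo a b, (Cδ * (b - a) ^ δ * (y - a) ^ γ +
          Cγ * (b - a) ^ γ * (b - y) ^ δ)) := by
        rw [ofReal_integral_eq_lintegral_ofReal hI]
        refine (ae_restrict_iff' measurableSet_Ioo).2 (Eventually.of_forall fun y hy => ?_)
        have h1 : 0 < y - a := sub_pos.2 hy.1
        have h2 : 0 < b - y := sub_pos.2 hy.2
        show (0 : ℝ) ≤ _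
        positivity
    _ = _ := by
        congr 1
        rw [← integral_Ioc_eq_integral_Ioo, ← intervalIntegral.integral_of_le hab.le,
          intervalIntegral.integral_add (iγ.const_mul _) (iδ.const_mul _),
          intervalIntegral.integral_const_mul, intervalIntegral.integral_const_mul, vγ, vδ,
          show (b - a) ^ (δ + 1) = (b - a) ^ δ * (b - a) by
            rw [Real.rpow_add hD, Real.rpow_one],
          show (b - a) ^ (γ + 1) = (b - a) ^ γ * (b - a) by
            rw [Real.rpow_add hD, Real.rpow_one],
          show (b - a) ^ (γ + δ + 1) = (b - a) ^ γ * (b - a) ^ δ * (b - a) by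
            rw [Real.rpow_add hD, Real.rpow_add hD, Real.rpow_one]]
        ring

/-- Serves twice: for the vertical fibres and then for the remaining integral in x. -/
lemma lintegral_le_of_jacobi_bound {F : ℝ → ℝ≥0∞} {a b c γ δ K : ℝ} (hc : 0 ≤ c)
    (hK : ∫⁻ y in Ioo a b, ENNReal.ofReal ((y - a) ^ γ * (b - y) ^ δ) ≤
        ENNReal.ofReal (K * (b - a) ^ (γ + δ + 1)))
    (hF : ∀ y, y ∉ Ioo a b → F y = 0)
    (hF' : ∀ y ∈ Ioo a b, F y ≤ ENNReal.ofReal (c * ((y - a) ^ γ * (b - y) ^ δ))) :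
    ∫⁻ y, F y ≤ ENNReal.ofReal (c * (K * (b - a) ^ (γ + δ + 1))) := by
  have : ∫⁻ y, F y = ∫⁻ y in Ioo a b, F y := by
    rw [← lintegral_indicator measurableSet_Ioo]
    congr 1
    ext y
    by_cases hy : y ∈ Ioo a b
    · rw [indicator_of_mem hy]
    · rw [indicator_of_notMem hy, hF y hy]
  rw [this]
  calc ∫⁻ y in Ioo a b, F y
      ≤ ∫⁻ y in Ioo a b, ENNReal.ofReal c * ENNReal.ofReal ((y - a) ^ γ * (b - y) ^ δ) := by
        refine setLIntegral_mono' measurableSet_Ioo fun y hy => ?_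
        rw [← ENNReal.ofReal_mul hc]
        exact hF' y hy
    _ = ENNReal.ofReal c * ∫⁻ y in Ioo a b, ENNReal.ofReal ((y - a) ^ γ * (b - y) ^ δ) := by
        rw [lintegral_const_mul' _ _ ENNReal.ofReal_ne_top]
    _ ≤ _ := by
        rw [ENNReal.ofReal_mul hc]
        gcongr

/-- Covers both signs of the exponent: a nonnegative power is bounded by its value at the upper
bound, a negative one by its value at the lower bound. -/
lemma rpow_le_of_le_of_le {a s M e : ℝ} (ha : 0 < a) (has : a ≤ s) (hsM : s ≤ M) :
    s ^ e ≤ (1 + M ^ |e|) * a ^ min e 0 := by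
  have hM : 0 < M := by linarith
  have h1 : 0 < M ^ |e| := Real.rpow_pos_of_pos hM _
  rcases le_total 0 e with he | he
  · rw [min_eq_right he, Real.rpow_zero, abs_of_nonneg he] at *
    have := Real.rpow_le_rpow (by linarith) hsM he
    linarith
  · rw [min_eq_left he]
    have := Real.rpow_le_rpow_of_nonpos ha has he
    have h2 : 0 < a ^ e := Real.rpow_pos_of_pos ha _
    nlinarith

lemma rpow_le_of_comparable {c₁ c₂ r s e : ℝ} (hc₁ : 0 < c₁) (hc₂ : 0 < c₂) (hr : 0 < r)
    (h₁ : c₁ * r ≤ s) (h₂ : s ≤ c₂ * r) : s ^ e ≤ (c₁ ^ e + c₂ ^ e) * r ^ e := by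
  have hs : 0 < s := lt_of_lt_of_le (by positivity) h₁
  rw [add_mul, ← Real.mul_rpow hc₁.le hr.le, ← Real.mul_rpow hc₂.le hr.le]
  rcases le_total 0 e with he | he
  · have := Real.rpow_le_rpow hs.le h₂ he
    have : 0 ≤ (c₁ * r) ^ e := by positivity
    linarith
  · have := Real.rpow_le_rpow_of_nonpos (by positivity) h₁ he
    have : 0 ≤ (c₂ * r) ^ e := by positivity
    linarith

/-- The constant factor of the weight. -/
def weightConst (α β : ℝ) : ℝ := (4 * Real.pi ^ 2) ^ (α + β) / 3 ^ (2 * α + β)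

lemma weightConst_pos (α β : ℝ) : 0 < weightConst α β := by
  have := Real.pi_pos
  unfold weightConst; positivity

lemma weight_eq (α β : ℝ) (z : ℝ × ℝ) :
    weight α β z = weightConst α β * (p z ^ α * q z ^ β) := by
  simp only [weight, weightConst]; ring

lemma measurable_weight (α β : ℝ) : Measurable (weight α β) := by
  have h1 := continuous_p.measurable
  have h2 := continuous_q.measurable
  unfold weight
  fun_prop

lemma weight_nonneg {α β : ℝ} {z : ℝ × ℝ} (hz : z ∈ region) : 0 ≤ weight α β z := by
  rw [weight_eq]
  exact mul_nonneg (weightConst_pos α β).le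
    (mul_nonneg (Real.rpow_nonneg hz.1 _) (Real.rpow_nonneg hz.2 _))

lemma weight_pos {α β : ℝ} {z : ℝ × ℝ} (hz : z ∈ interiorRegion) : 0 < weight α β z := by
  rw [weight_eq]
  exact mul_pos (weightConst_pos α β)
    (mul_pos (Real.rpow_pos_of_pos hz.1 _) (Real.rpow_pos_of_pos hz.2 _))

/-- The fibre integral of the weight left of the corner `(-1/3, -1/3)`. -/
lemma exists_fiber_left_le {α β : ℝ} (hβ : -1 < β) (k : ℕ) :
    ∃ C : ℝ, 0 ≤ C ∧ ∀ x ∈ Ioo (-1 / 2 : ℝ) (-1 / 3),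
      ∫⁻ y, interiorRegion.indicator (fun z => ENNReal.ofReal (weight α β z *
        ((2 * z.1 + 1) * (1 - z.1) ^ k))) (x, y) ≤
        ENNReal.ofReal (C * ((x - -1 / 2) ^ (-1 / 2 : ℝ) * (-1 / 3 - x) ^ min α 0)) := by
  obtain ⟨K, hK0, hK⟩ := exists_lintegral_jacobi_le hβ hβ
  set M : ℝ := 1 + 9 ^ |α|
  have hM : 0 ≤ M := by positivity
  have hc := weightConst_pos α β
  set E : ℝ := 18 ^ (2 * β + 1)
  have hE : 0 ≤ E := by positivity
  set H : ℝ := (2 / 3) ^ (-1 / 2 : ℝ)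
  have hH : 0 ≤ H := by positivity
  set N : ℝ := 3 ^ min α 0
  have hN : 0 ≤ N := by positivity
  refine ⟨weightConst α β * M * N * 3 * 2 ^ k * K * E * H, by positivity, fun x hx => ?_⟩
  obtain ⟨hx1, hx2⟩ := hx
  obtain ⟨t, ht0, ht⟩ : ∃ t : ℝ, 0 < t ∧ x = (3 * t ^ 2 - 1) / 2 := by
    refine ⟨√((2 * x + 1) / 3), Real.sqrt_pos.2 (by linarith), ?_⟩
    rw [Real.sq_sqrt (by linarith)]; ring
  have ht3 : t < 1 / 3 := by
    by_contra! h
    nlinarith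
  set a : ℝ := 3 * (-1 / 3 - x) with ha
  have ha0 : 0 < a := by linarith
  have hA0 : 0 ≤ (-1 / 3 - x) ^ min α 0 := Real.rpow_nonneg (by linarith) _
  set c : ℝ := weightConst α β * (M * a ^ min α 0) * (3 * t ^ 2 * 2 ^ k) with hcdef
  have hc0 : 0 ≤ c := by positivity
  have hul : upper t - lowerQ t = 18 * t ^ 3 := by simp only [upper, lowerQ]; ring
  have hlt : lowerQ t < upper t := by
    have : 0 < t ^ 3 := by positivity
    linarith
  have step := lintegral_le_of_jacobi_bound (F := fun y => interiorRegion.indicator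
      (fun z => ENNReal.ofReal (weight α β z * ((2 * z.1 + 1) * (1 - z.1) ^ k))) (x, y))
      hc0 (hK (lowerQ t) (upper t) hlt) ?_ ?_
  · refine step.trans (ENNReal.ofReal_le_ofReal ?_)
    -- The fibre has length 18t³ and contributes t^(6β+3); the damping factor 2x + 1 = 3t² raises
    -- this to (t²)^(3β+5/2). As β > -1 the exponent exceeds -1/2, and (x + 1/2)^(-1/2) is
    -- integrable.
    have e1 : (upper t - lowerQ t) ^ (β + β + 1) * t ^ 2 ≤
        E * H * (x - -1 / 2) ^ (-1 / 2 : ℝ) := by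
      rw [hul, Real.mul_rpow (by norm_num) (by positivity), show β + β + 1 = 2 * β + 1 by ring]
      have e2 : (t ^ 3) ^ (2 * β + 1) * t ^ 2 = (t ^ 2) ^ (3 * β + 5 / 2) := by
        rw [← Real.rpow_natCast, ← Real.rpow_natCast, ← Real.rpow_mul ht0.le,
          ← Real.rpow_mul ht0.le, ← Real.rpow_add ht0]
        congr 1; push_cast; ring
      have e3 : (t ^ 2) ^ (3 * β + 5 / 2) ≤ (t ^ 2) ^ (-1 / 2 : ℝ) :=
        Real.rpow_le_rpow_of_exponent_ge (by positivity) (by nlinarith) (by linarith)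
      have e4 : (t ^ 2) ^ (-1 / 2 : ℝ) = H * (x - -1 / 2) ^ (-1 / 2 : ℝ) := by
        rw [← Real.mul_rpow (by norm_num) (by linarith)]
        congr 1; rw [ht]; ring
      calc E * (t ^ 3) ^ (2 * β + 1) * t ^ 2 = E * ((t ^ 3) ^ (2 * β + 1) * t ^ 2) := by ring
        _ ≤ E * (H * (x - -1 / 2) ^ (-1 / 2 : ℝ)) := by
          rw [e2, ← e4]; gcongr
        _ = _ := by ring
    have e5 : a ^ min α 0 = N * (-1 / 3 - x) ^ min α 0 :=
      Real.mul_rpow (by norm_num) (by linarith)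
    calc c * (K * (upper t - lowerQ t) ^ (β + β + 1))
        = weightConst α β * M * a ^ min α 0 * 3 * 2 ^ k * K *
          ((upper t - lowerQ t) ^ (β + β + 1) * t ^ 2) := by rw [hcdef]; ring
      _ ≤ weightConst α β * M * a ^ min α 0 * 3 * 2 ^ k * K *
          (E * H * (x - -1 / 2) ^ (-1 / 2 : ℝ)) := by gcongr
      _ = _ := by rw [e5]; ring
  · intro y hy
    apply indicator_of_notMem
    contrapose! hy
    have hq := hy.2
    rw [ht, q_param] at hq
    constructor <;> by_contra! h <;> nlinarith
  · intro y hy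
    obtain ⟨hy1, hy2⟩ := hy
    by_cases hm : (x, y) ∈ interiorRegion
    swap
    · rw [indicator_of_notMem hm]; exact zero_le
    rw [indicator_of_mem hm]
    refine ENNReal.ofReal_le_ofReal ?_
    have hp : p (x, y) = 2 * (y - lowerQ t) + 9 / 4 * (1 + t) ^ 3 * (1 - 3 * t) := by
      rw [ht, p_param]; simp only [lowerP, lowerQ, upper]; ring
    -- Left of the corner the parabola runs below the lower branch of q = 0, with a gap proportional
    -- to (1 + t)³(1 - 3t). So p is bounded below by a multiple of the horizontal distance to the
    -- corner.
    have hp1 : a ≤ p (x, y) := by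
      have : a = (1 - 3 * t) * ((1 + 3 * t) * (1 / 2)) := by rw [ha, ht]; ring
      rw [hp, this]
      have h1 : (1 - 3 * t) * ((1 + 3 * t) * (1 / 2)) ≤ (1 - 3 * t) * (9 / 4 * (1 + t) ^ 3) := by
        apply mul_le_mul_of_nonneg_left _ (by linarith)
        have : 1 ≤ (1 + t) ^ 3 := one_le_pow₀ (by linarith)
        nlinarith
      linarith
    have hp2 : p (x, y) ≤ 9 := by
      rw [ht, p_param]
      have : upper t - lowerP t ≤ 9 / 8 * 2 := by
        have : upper t - lowerP t = 9 / 8 * ((1 - t) ^ 3 * (3 * t + 1)) := by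
          simp only [lowerP]; ring
        rw [this]
        have h1 : (1 - t) ^ 3 ≤ 1 := pow_le_one₀ (by linarith) (by linarith)
        have h0 : 0 ≤ (1 - t) ^ 3 := pow_nonneg (by linarith) _
        nlinarith
      linarith
    have hpα := rpow_le_of_le_of_le (e := α) ha0 hp1 hp2
    have hqβ : q (x, y) ^ β = (y - lowerQ t) ^ β * (upper t - y) ^ β := by
      rw [ht, q_param, mul_comm, Real.mul_rpow (by linarith) (by linarith)]
    have hw0 : 0 ≤ (y - lowerQ t) ^ β * (upper t - y) ^ β :=
      mul_nonneg (Real.rpow_nonneg (by linarith) _) (Real.rpow_nonneg (by linarith) _)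
    have hmx : (2 * x + 1) * (1 - x) ^ k ≤ 3 * t ^ 2 * 2 ^ k := by
      have : 2 * x + 1 = 3 * t ^ 2 := by rw [ht]; ring
      rw [this]
      gcongr <;> linarith
    have hmx0 : 0 ≤ (2 * x + 1) * (1 - x) ^ k :=
      mul_nonneg (by linarith) (pow_nonneg (by linarith) _)
    rw [weight_eq, hqβ]
    have hp0 : 0 ≤ p (x, y) ^ α := Real.rpow_nonneg hm.1.le _
    calc weightConst α β * (p (x, y) ^ α * ((y - lowerQ t) ^ β * (upper t - y) ^ β)) *
          ((2 * x + 1) * (1 - x) ^ k)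
        ≤ weightConst α β * (M * a ^ min α 0 * ((y - lowerQ t) ^ β * (upper t - y) ^ β)) *
          (3 * t ^ 2 * 2 ^ k) := by gcongr
      _ = _ := by rw [hcdef]; ring

/-- The fibre integral of the weight right of the corner `(-1/3, -1/3)`. -/
lemma exists_fiber_right_le {α β : ℝ} (hα : -1 < α) (hβ : -1 < β) (k : ℕ) :
    ∃ C : ℝ, 0 ≤ C ∧ ∀ x ∈ Ioo (-1 / 3 : ℝ) 1,
      ∫⁻ y, interiorRegion.indicator (fun z => ENNReal.ofReal (weight α β z *
        ((2 * z.1 + 1) * (1 - z.1) ^ k))) (x, y) ≤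
        ENNReal.ofReal (C * ((x - -1 / 3) ^ min β 0 *
          (1 - x) ^ (3 * (α + β + 1) + k))) := by
  obtain ⟨K, hK0, hK⟩ := exists_lintegral_jacobi_le hα hβ
  set M : ℝ := 1 + 18 ^ |β|
  have hM : 0 ≤ M := by positivity
  have hc := weightConst_pos α β
  set E : ℝ := (1 / 24) ^ (α + β + 1) + (4 / 3) ^ (α + β + 1)
  have hE : 0 ≤ E := by positivity
  set H : ℝ := 2 ^ α
  have hH : 0 ≤ H := by positivity
  refine ⟨weightConst α β * H * M * 3 * K * E, by positivity, fun x hx => ?_⟩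
  obtain ⟨hx1, hx2⟩ := hx
  obtain ⟨t, ht0, ht⟩ : ∃ t : ℝ, 0 < t ∧ x = (3 * t ^ 2 - 1) / 2 := by
    refine ⟨√((2 * x + 1) / 3), Real.sqrt_pos.2 (by linarith), ?_⟩
    rw [Real.sq_sqrt (by linarith)]; ring
  have ht3 : 1 / 3 < t := by
    by_contra! h
    nlinarith
  have ht1 : t < 1 := by
    by_contra! h
    nlinarith
  set a : ℝ := x - -1 / 3 with ha
  have ha0 : 0 < a := by linarith
  set c : ℝ := weightConst α β * (H * (M * a ^ min β 0)) * (3 * (1 - x) ^ k) with hcdef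
  have h1x : 0 < 1 - x := by linarith
  have hc0 : 0 ≤ c := by positivity
  have hul : upper t - lowerP t = 9 / 8 * (1 - t) ^ 3 * (3 * t + 1) := by
    simp only [lowerP]; ring
  have h1t : 0 < (1 - t) ^ 3 := pow_pos (by linarith) _
  have hlt : lowerP t < upper t := by
    have : 0 < 9 / 8 * (1 - t) ^ 3 * (3 * t + 1) := by positivity
    linarith
  have hpq : lowerP t - lowerQ t = 9 / 8 * ((1 + t) ^ 3 * (3 * t - 1)) := by
    simp only [lowerP, lowerQ, upper]; ring
  have step := lintegral_le_of_jacobi_bound (F := fun y => interiorRegion.indicator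
      (fun z => ENNReal.ofReal (weight α β z * ((2 * z.1 + 1) * (1 - z.1) ^ k))) (x, y))
      hc0 (hK (lowerP t) (upper t) hlt) ?_ ?_
  · refine step.trans (ENNReal.ofReal_le_ofReal ?_)
    have e0 : (1 - x) ^ 3 = 27 / 8 * ((1 - t) ^ 3 * (1 + t) ^ 3) := by rw [ht]; ring
    -- The width of the horn is comparable to (1 - x)³: the ratio is (3t + 1)/(3(1 + t)³), which
    -- lies between 1/24 and 4/3.
    have e1 : (upper t - lowerP t) ^ (α + β + 1) ≤ E * ((1 - x) ^ 3) ^ (α + β + 1) := by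
      apply rpow_le_of_comparable (by norm_num) (by norm_num) (by positivity)
      · rw [hul, e0]
        have : (1 + t) ^ 3 ≤ 2 ^ 3 := by gcongr; linarith
        have : (1 - t) ^ 3 * (1 + t) ^ 3 ≤ (1 - t) ^ 3 * (8 * (3 * t + 1)) := by
          gcongr; linarith
        linarith
      · rw [hul, e0]
        have : (1 - t) ^ 3 * (3 * t + 1) ≤ (1 - t) ^ 3 * (4 * (1 + t) ^ 3) := by
          gcongr
          have : 1 ≤ (1 + t) ^ 3 := one_le_pow₀ (by linarith)
          linarith
        linarith
    have e2 : ((1 - x) ^ 3) ^ (α + β + 1) * (1 - x) ^ k = (1 - x) ^ (3 * (α + β + 1) + k) := by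
      rw [Real.rpow_add h1x, Real.rpow_mul h1x.le, Real.rpow_natCast]
      norm_cast
    calc c * (K * (upper t - lowerP t) ^ (α + β + 1))
        ≤ c * (K * (E * ((1 - x) ^ 3) ^ (α + β + 1))) := by gcongr
      _ = weightConst α β * H * M * 3 * K * E * (a ^ min β 0 *
          (((1 - x) ^ 3) ^ (α + β + 1) * (1 - x) ^ k)) := by rw [hcdef]; ring
      _ = _ := by rw [e2]
  · intro y hy
    apply indicator_of_notMem
    contrapose! hy
    have hp := hy.1
    have hq := hy.2
    rw [ht, q_param] at hq
    rw [ht, p_param] at hp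
    have : 0 < (1 + t) ^ 3 * (3 * t - 1) := mul_pos (by positivity) (by linarith)
    constructor
    · linarith
    · by_contra! h
      nlinarith
  · intro y hy
    obtain ⟨hy1, hy2⟩ := hy
    by_cases hm : (x, y) ∈ interiorRegion
    swap
    · rw [indicator_of_notMem hm]; exact zero_le
    rw [indicator_of_mem hm]
    refine ENNReal.ofReal_le_ofReal ?_
    have hq1 : a ≤ y - lowerQ t := by
      have e : a = (3 * t - 1) * ((3 * t + 1) * (1 / 6)) := by rw [ha, ht]; ring
      rw [e]
      have h1 : (3 * t - 1) * ((3 * t + 1) * (1 / 6)) ≤ (3 * t - 1) * (9 / 8 * (1 + t) ^ 3) := by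
        apply mul_le_mul_of_nonneg_left _ (by linarith)
        have : 1 ≤ (1 + t) ^ 3 := one_le_pow₀ (by linarith)
        nlinarith
      linarith
    have hq2 : y - lowerQ t ≤ 18 := by
      have h1 : upper t - lowerQ t = 18 * t ^ 3 := by simp only [upper, lowerQ]; ring
      have h2 : t ^ 3 ≤ 1 := pow_le_one₀ ht0.le ht1.le
      linarith
    have hqβ := rpow_le_of_le_of_le (e := β) ha0 hq1 hq2
    have hq' : q (x, y) ^ β = (upper t - y) ^ β * (y - lowerQ t) ^ β := by
      rw [ht, q_param, Real.mul_rpow (by linarith) (by linarith)]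
    have hp' : p (x, y) ^ α = H * (y - lowerP t) ^ α := by
      rw [ht, p_param, Real.mul_rpow (by linarith) (by linarith)]
    have r1 : 0 ≤ (upper t - y) ^ β := Real.rpow_nonneg (by linarith) _
    have r2 : 0 ≤ (y - lowerP t) ^ α := Real.rpow_nonneg (by linarith) _
    have hmx : (2 * x + 1) * (1 - x) ^ k ≤ 3 * (1 - x) ^ k := by gcongr; linarith
    have hmx0 : 0 ≤ (2 * x + 1) * (1 - x) ^ k :=
      mul_nonneg (by linarith) (pow_nonneg (by linarith) _)
    rw [weight_eq, hq', hp']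
    calc weightConst α β * (H * (y - lowerP t) ^ α *
            ((upper t - y) ^ β * (y - lowerQ t) ^ β)) * ((2 * x + 1) * (1 - x) ^ k)
        ≤ weightConst α β * (H * (y - lowerP t) ^ α *
            ((upper t - y) ^ β * (M * a ^ min β 0))) * (3 * (1 - x) ^ k) := by gcongr
      _ = _ := by rw [hcdef]; ring

/-- The weight becomes integrable after multiplication with suitable powers of the distances
to the cusp and to the horn of the triangle. -/
lemma integrableOn_weight_mul {α β : ℝ} (hα : -1 < α) (hβ : -1 < β) {k : ℕ}
    (hk : -1 < 3 * (α + β + 1) + k) :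
    IntegrableOn (fun z => weight α β z * ((2 * z.1 + 1) * (1 - z.1) ^ k)) region := by
  have hmeas : Measurable fun z : ℝ × ℝ => weight α β z * ((2 * z.1 + 1) * (1 - z.1) ^ k) :=
    (measurable_weight α β).mul (by fun_prop)
  rw [IntegrableOn, ← restrict_interiorRegion]
  refine ⟨hmeas.aestronglyMeasurable, ?_⟩
  rw [hasFiniteIntegral_iff_ofReal]
  swap
  · refine (ae_restrict_iff' isOpen_interiorRegion.measurableSet).2 (Eventually.of_forall ?_)
    intro z hz
    have := fst_mem_of_mem_region (interiorRegion_subset hz)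
    exact mul_nonneg (weight_pos hz).le
      (mul_nonneg (by linarith [this.1]) (pow_nonneg (by linarith [this.2]) _))
  rw [← lintegral_indicator isOpen_interiorRegion.measurableSet, Measure.volume_eq_prod,
    lintegral_prod _ (hmeas.ennreal_ofReal.indicator
      isOpen_interiorRegion.measurableSet).aemeasurable]
  obtain ⟨C₁, hC₁, h₁⟩ := exists_fiber_left_le (α := α) hβ k
  obtain ⟨C₂, hC₂, h₂⟩ := exists_fiber_right_le hα hβ k
  obtain ⟨K₁, -, hK₁⟩ := exists_lintegral_jacobi_le (γ := -1 / 2) (δ := min α 0)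
    (by norm_num) (lt_min hα (by norm_num))
  obtain ⟨K₂, -, hK₂⟩ := exists_lintegral_jacobi_le (γ := min β 0)
    (lt_min hβ (by norm_num)) hk
  set G₁ : ℝ → ℝ≥0∞ := (Ioo (-1 / 2 : ℝ) (-1 / 3)).indicator fun x =>
    ENNReal.ofReal (C₁ * ((x - -1 / 2) ^ (-1 / 2 : ℝ) * (-1 / 3 - x) ^ min α 0)) with hG₁
  set G₂ : ℝ → ℝ≥0∞ := (Ioo (-1 / 3 : ℝ) 1).indicator fun x =>
    ENNReal.ofReal (C₂ * ((x - -1 / 3) ^ min β 0 * (1 - x) ^ (3 * (α + β + 1) + k))) with hG₂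
  have b₁ := lintegral_le_of_jacobi_bound (F := G₁) hC₁
    (hK₁ (-1 / 2) (-1 / 3) (by norm_num)) (fun y hy => indicator_of_notMem hy _)
    (fun y hy => by rw [hG₁, indicator_of_mem hy])
  have b₂ := lintegral_le_of_jacobi_bound (F := G₂) hC₂
    (hK₂ (-1 / 3) 1 (by norm_num)) (fun y hy => indicator_of_notMem hy _)
    (fun y hy => by rw [hG₂, indicator_of_mem hy])
  have hG₁m : Measurable G₁ := by
    refine Measurable.indicator ?_ measurableSet_Ioo
    fun_prop
  calc _ ≤ ∫⁻ x, (G₁ x + G₂ x) := by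
        refine lintegral_mono_ae ?_
        have hne : ∀ᵐ x : ℝ, x ≠ -1 / 3 := by simp [ae_iff, measure_singleton]
        filter_upwards [hne] with x hx
        by_cases hx1 : x ∈ Ioo (-1 / 2 : ℝ) (-1 / 3)
        · refine (h₁ x hx1).trans (le_trans ?_ le_self_add)
          rw [hG₁, indicator_of_mem hx1]
        by_cases hx2 : x ∈ Ioo (-1 / 3 : ℝ) 1
        · refine (h₂ x hx2).trans (le_trans ?_ le_add_self)
          rw [hG₂, indicator_of_mem hx2]
        have : ∀ y, (x, y) ∉ interiorRegion := by
          intro y hy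
          obtain ⟨t, ⟨ht0, ht1⟩, ht, -, -⟩ := exists_param_of_mem_interior hy
          simp only at ht
          rcases lt_or_gt_of_ne hx with h | h
          · exact hx1 ⟨by rw [ht]; nlinarith [pow_pos ht0 2], h⟩
          · exact hx2 ⟨h, by rw [ht]; nlinarith⟩
        simp [indicator_of_notMem (this _)]
    _ = (∫⁻ x, G₁ x) + ∫⁻ x, G₂ x := lintegral_add_left hG₁m _
    _ < ∞ := ENNReal.add_lt_top.2
        ⟨b₁.trans_lt ENNReal.ofReal_lt_top, b₂.trans_lt ENNReal.ofReal_lt_top⟩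

/-! ### The operator in polynomial form. -/

lemma hasFDerivAt_p (z : ℝ × ℝ) :
    HasFDerivAt p ((-6 * z.1) • ContinuousLinearMap.fst ℝ ℝ ℝ +
      (2 : ℝ) • ContinuousLinearMap.snd ℝ ℝ ℝ) z := by
  have hx : HasFDerivAt (fun z : ℝ × ℝ => z.1) (ContinuousLinearMap.fst ℝ ℝ ℝ) z := hasFDerivAt_fst
  have hy : HasFDerivAt (fun z : ℝ × ℝ => z.2) (ContinuousLinearMap.snd ℝ ℝ ℝ) z := hasFDerivAt_snd
  refine HasFDerivAt.congr_fderiv (((hasFDerivAt_const (1 : ℝ) z).add (hy.const_mul 2)).sub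
    ((hx.pow 2).const_mul 3)) ?_
  ext <;> simp
  ring

lemma hasFDerivAt_q (z : ℝ × ℝ) :
    HasFDerivAt q ((72 * z.1 ^ 2 - 12 * z.2 - 6) • ContinuousLinearMap.fst ℝ ℝ ℝ +
      (-2 * z.2 - 12 * z.1 - 4) • ContinuousLinearMap.snd ℝ ℝ ℝ) z := by
  have hx : HasFDerivAt (fun z : ℝ × ℝ => z.1) (ContinuousLinearMap.fst ℝ ℝ ℝ) z := hasFDerivAt_fst
  have hy : HasFDerivAt (fun z : ℝ × ℝ => z.2) (ContinuousLinearMap.snd ℝ ℝ ℝ) z := hasFDerivAt_snd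
  refine HasFDerivAt.congr_fderiv ((((((hx.pow 3).const_mul 24).sub (hy.pow 2)).sub
    ((hx.const_mul 12).mul hy)).sub (hx.const_mul 6)).sub (hy.const_mul 4) |>.sub
    (hasFDerivAt_const (1 : ℝ) z)) ?_
  ext <;> simp
  ring

lemma hasFDerivAt_A₁₁ (z : ℝ × ℝ) :
    HasFDerivAt A₁₁ ((-12 * z.1 + 3) • ContinuousLinearMap.fst ℝ ℝ ℝ +
      (1 : ℝ) • ContinuousLinearMap.snd ℝ ℝ ℝ) z := by
  have hx : HasFDerivAt (fun z : ℝ × ℝ => z.1) (ContinuousLinearMap.fst ℝ ℝ ℝ) z := hasFDerivAt_fst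
  have hy : HasFDerivAt (fun z : ℝ × ℝ => z.2) (ContinuousLinearMap.snd ℝ ℝ ℝ) z := hasFDerivAt_snd
  refine HasFDerivAt.congr_fderiv (((((hx.pow 2).const_mul (-6)).add hy).add
    (hx.const_mul 3)).add (hasFDerivAt_const (2 : ℝ) z)) ?_
  ext <;> simp
  ring

lemma hasFDerivAt_A₁₂ (z : ℝ × ℝ) :
    HasFDerivAt A₁₂ ((-9 * z.2 + 36 * z.1) • ContinuousLinearMap.fst ℝ ℝ ℝ +
      (-9 * z.1 - 6) • ContinuousLinearMap.snd ℝ ℝ ℝ) z := by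
  have hx : HasFDerivAt (fun z : ℝ × ℝ => z.1) (ContinuousLinearMap.fst ℝ ℝ ℝ) z := hasFDerivAt_fst
  have hy : HasFDerivAt (fun z : ℝ × ℝ => z.2) (ContinuousLinearMap.snd ℝ ℝ ℝ) z := hasFDerivAt_snd
  refine HasFDerivAt.congr_fderiv (((((hx.const_mul (-9)).mul hy).add
    ((hx.pow 2).const_mul 18)).sub (hy.const_mul 6)).sub (hasFDerivAt_const (3 : ℝ) z)) ?_
  ext <;> simp
  ring

lemma hasFDerivAt_A₂₂ (z : ℝ × ℝ) :
    HasFDerivAt A₂₂ ((324 * z.1 ^ 2 - 54 * z.2 - 27) • ContinuousLinearMap.fst ℝ ℝ ℝ +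
      (-36 * z.2 - 54 * z.1 - 9) • ContinuousLinearMap.snd ℝ ℝ ℝ) z := by
  have hx : HasFDerivAt (fun z : ℝ × ℝ => z.1) (ContinuousLinearMap.fst ℝ ℝ ℝ) z := hasFDerivAt_fst
  have hy : HasFDerivAt (fun z : ℝ × ℝ => z.2) (ContinuousLinearMap.snd ℝ ℝ ℝ) z := hasFDerivAt_snd
  refine HasFDerivAt.congr_fderiv ((((((hy.pow 2).const_mul (-18)).add
    ((hx.pow 3).const_mul 108)).sub ((hx.const_mul 54).mul hy)).sub (hx.const_mul 27)).sub
    (hy.const_mul 9)) ?_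
  ext <;> (simp; ring)

/-- The derivative `Λ∇p · ∇f / p` along the conormal of the curve `p = 0`. -/
def conormalP (f : ℝ × ℝ → ℂ) (z : ℝ × ℝ) : ℂ :=
  (-6 - 12 * z.1 : ℝ) * dx f z + (-18 * z.2 - 36 * z.1 : ℝ) * dy f z

/-- The derivative `Λ∇q · ∇f / q` along the conormal of the curve `q = 0`. -/
def conormalQ (f : ℝ × ℝ → ℂ) (z : ℝ × ℝ) : ℂ :=
  (-18 * z.1 : ℝ) * dx f z + (-36 * z.2 - 18 : ℝ) * dy f z

/-- The first component of `Λ∇f`. -/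
def flux₁ (f : ℝ × ℝ → ℂ) (z : ℝ × ℝ) : ℂ := (A₁₁ z : ℂ) * dx f z + (A₁₂ z : ℂ) * dy f z

/-- The second component of `Λ∇f`. -/
def flux₂ (f : ℝ × ℝ → ℂ) (z : ℝ × ℝ) : ℂ := (A₁₂ z : ℂ) * dx f z + (A₂₂ z : ℂ) * dy f z

/-- Λ∇p is p times a polynomial vector field: the curve p = 0 is characteristic. This one identity
removes both the singularity of L and the boundary term in Green's formula. -/
lemma flux_p (f : ℝ × ℝ → ℂ) (z : ℝ × ℝ) :
    (fderiv ℝ p z (1, 0) : ℂ) * flux₁ f z + (fderiv ℝ p z (0, 1) : ℂ) * flux₂ f z =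
      p z * conormalP f z := by
  rw [(hasFDerivAt_p z).fderiv]
  simp only [flux₁, flux₂, conormalP, p, A₁₁, A₁₂, A₂₂, add_apply,
    smul_apply, ContinuousLinearMap.coe_fst', ContinuousLinearMap.coe_snd',
    smul_eq_mul]
  push_cast
  ring

lemma flux_q (f : ℝ × ℝ → ℂ) (z : ℝ × ℝ) :
    (fderiv ℝ q z (1, 0) : ℂ) * flux₁ f z + (fderiv ℝ q z (0, 1) : ℂ) * flux₂ f z =
      q z * conormalQ f z := by
  rw [(hasFDerivAt_q z).fderiv]
  simp only [flux₁, flux₂, conormalQ, q, A₁₁, A₁₂, A₂₂, add_apply,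
    smul_apply, ContinuousLinearMap.coe_fst', ContinuousLinearMap.coe_snd',
    smul_eq_mul]
  push_cast
  ring

lemma fderiv_ofReal_mul {a : ℝ × ℝ → ℝ} {F : ℝ × ℝ → ℂ} {z : ℝ × ℝ}
    (ha : DifferentiableAt ℝ a z) (hF : DifferentiableAt ℝ F z) (v : ℝ × ℝ) :
    fderiv ℝ (fun u => (a u : ℂ) * F u) z v =
      a z * fderiv ℝ F z v + (fderiv ℝ a z v : ℂ) * F z := by
  have h : HasFDerivAt (fun u => (a u : ℂ)) (Complex.ofRealCLM.comp (fderiv ℝ a z)) z :=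
    Complex.ofRealCLM.hasFDerivAt.comp z ha.hasFDerivAt
  have h' : HasFDerivAt (fun u => (a u : ℂ) * F u) _ z := h.mul hF.hasFDerivAt
  rw [h'.fderiv]
  simp
  ring

lemma fderiv_ofReal_mul_add {a b : ℝ × ℝ → ℝ} {F G : ℝ × ℝ → ℂ} {z : ℝ × ℝ}
    (ha : DifferentiableAt ℝ a z) (hb : DifferentiableAt ℝ b z)
    (hF : DifferentiableAt ℝ F z) (hG : DifferentiableAt ℝ G z) (v : ℝ × ℝ) :
    fderiv ℝ (fun u => (a u : ℂ) * F u + (b u : ℂ) * G u) z v =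
      a z * fderiv ℝ F z v + (fderiv ℝ a z v : ℂ) * F z +
        (b z * fderiv ℝ G z v + (fderiv ℝ b z v : ℂ) * G z) := by
  have c : ∀ {a : ℝ × ℝ → ℝ} {F : ℝ × ℝ → ℂ}, DifferentiableAt ℝ a z → DifferentiableAt ℝ F z →
      DifferentiableAt ℝ (fun u => (a u : ℂ) * F u) z := fun ha hF =>
    (Complex.ofRealCLM.differentiableAt.comp z ha).mul hF
  rw [fderiv_fun_add (c ha hF) (c hb hG), add_apply, fderiv_ofReal_mul ha hF,
    fderiv_ofReal_mul hb hG]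

lemma hasFDerivAt_weight {α β : ℝ} {z : ℝ × ℝ} (hz : z ∈ interiorRegion) :
    HasFDerivAt (weight α β) (weight α β z • ((α / p z) • fderiv ℝ p z +
      (β / q z) • fderiv ℝ q z)) z := by
  have hp := (hasFDerivAt_p z).differentiableAt.hasFDerivAt
  have hq := (hasFDerivAt_q z).differentiableAt.hasFDerivAt
  have h := ((hp.rpow_const (p := α) (Or.inl hz.1.ne')).mul
    (hq.rpow_const (p := β) (Or.inl hz.2.ne'))).const_mul (weightConst α β)
  have e : weight α β = fun u => weightConst α β * (p u ^ α * q u ^ β) :=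
    funext (weight_eq α β)
  rw [e]
  refine h.congr_fderiv ?_
  rw [Real.rpow_sub_one hz.1.ne', Real.rpow_sub_one hz.2.ne']
  have h1 := hz.1.ne'
  have h2 := hz.2.ne'
  apply ContinuousLinearMap.ext
  intro v
  simp
  field_simp
  ring

/-- The operator `-L` as a differential operator with polynomial coefficients. -/
def polyL (α β : ℝ) (f : ℝ × ℝ → ℂ) (z : ℝ × ℝ) : ℂ :=
  A₁₁ z * dx (dx f) z + A₁₂ z * dx (dy f) z + A₁₂ z * dy (dx f) z + A₂₂ z * dy (dy f) z +
    (-21 * z.1 - 3 : ℝ) * dx f z + (-45 * z.2 - 18 * z.1 - 9 : ℝ) * dy f z +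
    α * conormalP f z + β * conormalQ f z

lemma contDiffAt_fderiv_apply {f : ℝ × ℝ → ℂ} {z : ℝ × ℝ} (hf : ContDiffAt ℝ 2 f z) (v : ℝ × ℝ) :
    ContDiffAt ℝ 1 (fun u => fderiv ℝ f u v) z :=
  (hf.fderiv_right (m := 1) (by norm_num)).clm_apply contDiffAt_const

lemma contDiffAt_dx {f : ℝ × ℝ → ℂ} {z : ℝ × ℝ} (hf : ContDiffAt ℝ 2 f z) :
    ContDiffAt ℝ 1 (dx f) z := contDiffAt_fderiv_apply hf _

lemma contDiffAt_dy {f : ℝ × ℝ → ℂ} {z : ℝ × ℝ} (hf : ContDiffAt ℝ 2 f z) :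
    ContDiffAt ℝ 1 (dy f) z := contDiffAt_fderiv_apply hf _

lemma contDiff_coeffs : ContDiff ℝ 1 A₁₁ ∧ ContDiff ℝ 1 A₁₂ ∧ ContDiff ℝ 1 A₂₂ := by
  unfold A₁₁ A₁₂ A₂₂
  refine ⟨?_, ?_, ?_⟩ <;> fun_prop

lemma contDiffAt_flux₁ {f : ℝ × ℝ → ℂ} {z : ℝ × ℝ} (hf : ContDiffAt ℝ 2 f z) :
    ContDiffAt ℝ 1 (flux₁ f) z :=
  ((Complex.ofRealCLM.contDiff.comp contDiff_coeffs.1).contDiffAt.mul (contDiffAt_dx hf)).add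
    ((Complex.ofRealCLM.contDiff.comp contDiff_coeffs.2.1).contDiffAt.mul (contDiffAt_dy hf))

lemma contDiffAt_flux₂ {f : ℝ × ℝ → ℂ} {z : ℝ × ℝ} (hf : ContDiffAt ℝ 2 f z) :
    ContDiffAt ℝ 1 (flux₂ f) z :=
  ((Complex.ofRealCLM.contDiff.comp contDiff_coeffs.2.1).contDiffAt.mul (contDiffAt_dx hf)).add
    ((Complex.ofRealCLM.contDiff.comp contDiff_coeffs.2.2).contDiffAt.mul (contDiffAt_dy hf))

lemma contDiffAt_weight {α β : ℝ} {z : ℝ × ℝ} (hz : z ∈ interiorRegion) :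
    ContDiffAt ℝ 1 (fun u => (weight α β u : ℂ)) z := by
  have hp : ContDiffAt ℝ 1 p z := by unfold p; fun_prop
  have hq : ContDiffAt ℝ 1 q z := by unfold q; fun_prop
  have e : weight α β = fun u => weightConst α β * (p u ^ α * q u ^ β) :=
    funext (weight_eq α β)
  have h : ContDiffAt ℝ 1 (weight α β) z := by
    rw [e]
    exact contDiffAt_const.mul ((hp.rpow_const_of_ne hz.1.ne').mul (hq.rpow_const_of_ne hz.2.ne'))
  exact Complex.ofRealCLM.contDiff.contDiffAt.comp z h

/-- `div (Λ∇f)` in expanded form. -/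
lemma div_flux {f : ℝ × ℝ → ℂ} {z : ℝ × ℝ} (hf : ContDiffAt ℝ 2 f z) :
    dx (flux₁ f) z + dy (flux₂ f) z =
      A₁₁ z * dx (dx f) z + A₁₂ z * dx (dy f) z + A₁₂ z * dy (dx f) z + A₂₂ z * dy (dy f) z +
        (-21 * z.1 - 3 : ℝ) * dx f z + (-45 * z.2 - 18 * z.1 - 9 : ℝ) * dy f z := by
  have hx := (contDiffAt_dx hf).differentiableAt (by norm_num)
  have hy := (contDiffAt_dy hf).differentiableAt (by norm_num)
  have h1 := (hasFDerivAt_A₁₁ z).differentiableAt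
  have h2 := (hasFDerivAt_A₁₂ z).differentiableAt
  have h3 := (hasFDerivAt_A₂₂ z).differentiableAt
  have e1 : dx (flux₁ f) z = A₁₁ z * dx (dx f) z + (fderiv ℝ A₁₁ z (1, 0) : ℂ) * dx f z +
      (A₁₂ z * dx (dy f) z + (fderiv ℝ A₁₂ z (1, 0) : ℂ) * dy f z) :=
    fderiv_ofReal_mul_add h1 h2 hx hy _
  have e2 : dy (flux₂ f) z = A₁₂ z * dy (dx f) z + (fderiv ℝ A₁₂ z (0, 1) : ℂ) * dx f z +
      (A₂₂ z * dy (dy f) z + (fderiv ℝ A₂₂ z (0, 1) : ℂ) * dy f z) :=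
    fderiv_ofReal_mul_add h2 h3 hx hy _
  rw [e1, e2, (hasFDerivAt_A₁₁ z).fderiv, (hasFDerivAt_A₁₂ z).fderiv, (hasFDerivAt_A₂₂ z).fderiv]
  simp only [add_apply, smul_apply,
    ContinuousLinearMap.coe_fst', ContinuousLinearMap.coe_snd', smul_eq_mul]
  push_cast
  ring

lemma weight_neg_mul {α β : ℝ} {z : ℝ × ℝ} (hz : z ∈ interiorRegion) :
    weight (-α) (-β) z * weight α β z = 1 := by
  have h1 := (Real.rpow_pos_of_pos hz.1 α).ne'
  have h2 := (Real.rpow_pos_of_pos hz.2 β).ne'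
  have h3 : ((4 * Real.pi ^ 2) ^ (α + β) : ℝ) ≠ 0 := by have := Real.pi_pos; positivity
  have h4 : ((3 : ℝ) ^ (2 * α + β)) ≠ 0 := by positivity
  simp only [weight]
  rw [Real.rpow_neg hz.1.le, Real.rpow_neg hz.2.le, show -α + -β = -(α + β) by ring,
    show 2 * -α + -β = -(2 * α + β) by ring, Real.rpow_neg (by positivity),
    Real.rpow_neg (by norm_num)]
  field_simp

lemma weight_mul_L {α β : ℝ} {z : ℝ × ℝ} (hz : z ∈ interiorRegion) (f : ℝ × ℝ → ℂ) :
    (weight α β z : ℂ) * L α β f z =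
      -(dx (fun u => (weight α β u : ℂ) * flux₁ f u) z +
        dy (fun u => (weight α β u : ℂ) * flux₂ f u) z) := by
  have h : (weight (-α) (-β) z : ℂ) * (weight α β z : ℂ) = 1 := by
    exact_mod_cast weight_neg_mul hz
  simp only [L]
  change (weight α β z : ℂ) * (-(weight (-α) (-β) z : ℂ) *
    (dx (fun u => (weight α β u : ℂ) * flux₁ f u) z +
      dy (fun u => (weight α β u : ℂ) * flux₂ f u) z)) = _
  linear_combination -(dx (fun u => (weight α β u : ℂ) * flux₁ f u) z +
      dy (fun u => (weight α β u : ℂ) * flux₂ f u) z) * h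

/-- The logarithmic gradient of the weight is α∇p/p + β∇q/q. Paired with Λ∇f, its poles cancel,
leaving α and β times the two conormal derivatives. -/
lemma L_eq {α β : ℝ} {f : ℝ × ℝ → ℂ} {z : ℝ × ℝ} (hz : z ∈ interiorRegion)
    (hf : ContDiffAt ℝ 2 f z) : L α β f z = -polyL α β f z := by
  have hw : (weight α β z : ℂ) ≠ 0 := by exact_mod_cast (weight_pos hz).ne'
  have hp : (p z : ℂ) ≠ 0 := by exact_mod_cast hz.1.ne'
  have hq : (q z : ℂ) ≠ 0 := by exact_mod_cast hz.2.ne'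
  have h1 := (contDiffAt_flux₁ hf).differentiableAt (by norm_num)
  have h2 := (contDiffAt_flux₂ hf).differentiableAt (by norm_num)
  apply mul_left_cancel₀ hw
  rw [weight_mul_L hz]
  have e1 : dx (fun u => (weight α β u : ℂ) * flux₁ f u) z = _ :=
    fderiv_ofReal_mul (hasFDerivAt_weight hz).differentiableAt h1 _
  have e2 : dy (fun u => (weight α β u : ℂ) * flux₂ f u) z = _ :=
    fderiv_ofReal_mul (hasFDerivAt_weight hz).differentiableAt h2 _
  rw [e1, e2, (hasFDerivAt_weight hz).fderiv]
  have e3 : polyL α β f z = dx (flux₁ f) z + dy (flux₂ f) z +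
      α * conormalP f z + β * conormalQ f z := by rw [div_flux hf, polyL]
  have e4 := flux_p f z
  have e5 := flux_q f z
  rw [e3]
  have e6 : conormalP f z = ((fderiv ℝ p z (1, 0) : ℂ) * flux₁ f z +
      (fderiv ℝ p z (0, 1) : ℂ) * flux₂ f z) / p z := by rw [e4]; field_simp
  have e7 : conormalQ f z = ((fderiv ℝ q z (1, 0) : ℂ) * flux₁ f z +
      (fderiv ℝ q z (0, 1) : ℂ) * flux₂ f z) / q z := by rw [e5]; field_simp
  rw [e6, e7]
  simp only [add_apply, smul_apply, smul_eq_mul, dx, dy]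
  push_cast
  ring

lemma IsC2.continuousOn {f : ℝ × ℝ → ℂ} (hf : IsC2 f) : ContinuousOn f region :=
  fun z hz => (hf z hz).continuousAt.continuousWithinAt

lemma IsC2.continuousOn_dx {f : ℝ × ℝ → ℂ} (hf : IsC2 f) : ContinuousOn (dx f) region :=
  fun z hz => (contDiffAt_dx (hf z hz)).continuousAt.continuousWithinAt

lemma IsC2.continuousOn_dy {f : ℝ × ℝ → ℂ} (hf : IsC2 f) : ContinuousOn (dy f) region :=
  fun z hz => (contDiffAt_dy (hf z hz)).continuousAt.continuousWithinAt

lemma continuousAt_fderiv_apply {f : ℝ × ℝ → ℂ} {z : ℝ × ℝ} (hf : ContDiffAt ℝ 1 f z)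
    (v : ℝ × ℝ) : ContinuousAt (fun u => fderiv ℝ f u v) z :=
  ((hf.fderiv_right (m := 0) (by norm_num)).clm_apply contDiffAt_const).continuousAt

lemma IsC2.continuousOn_polyL {f : ℝ × ℝ → ℂ} (hf : IsC2 f) (α β : ℝ) :
    ContinuousOn (polyL α β f) region := by
  intro z hz
  have h1 := contDiffAt_dx (hf z hz)
  have h2 := contDiffAt_dy (hf z hz)
  have c1 := h1.continuousAt
  have c2 := h2.continuousAt
  have c3 : ContinuousAt (dx (dx f)) z := continuousAt_fderiv_apply h1 _
  have c4 : ContinuousAt (dy (dx f)) z := continuousAt_fderiv_apply h1 _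
  have c5 : ContinuousAt (dx (dy f)) z := continuousAt_fderiv_apply h2 _
  have c6 : ContinuousAt (dy (dy f)) z := continuousAt_fderiv_apply h2 _
  have a1 := contDiff_coeffs.1.continuous.continuousAt (x := z)
  have a2 := contDiff_coeffs.2.1.continuous.continuousAt (x := z)
  have a3 := contDiff_coeffs.2.2.continuous.continuousAt (x := z)
  apply ContinuousAt.continuousWithinAt
  unfold polyL conormalP conormalQ
  fun_prop

lemma IsC2.L_ae_eq {f : ℝ × ℝ → ℂ} (hf : IsC2 f) (α β : ℝ) :
    L α β f =ᵐ[volume.restrict region] fun z => -polyL α β f z := by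
  rw [← restrict_interiorRegion]
  exact (ae_restrict_iff' isOpen_interiorRegion.measurableSet).2
    (Eventually.of_forall fun z hz => L_eq hz (hf z (interiorRegion_subset hz)))

/-! ### Forced vanishing at the singular vertices and integrability of w·g. -/

/-- If `weight * h` is integrable near a point and `g = O(h)` there, then `weight * g` is
integrable near that point. -/
lemma integrableAtFilter_weight_mul_of_isBigO {α β : ℝ} {g : ℝ × ℝ → ℂ} {h : ℝ × ℝ → ℝ}
    {z : ℝ × ℝ} (hg : ContinuousOn g region)
    (hO : g =O[𝓝[region] z] h)
    (hh : IntegrableAtFilter (fun u => weight α β u * h u) (𝓝[region] z)) :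
    IntegrableAtFilter (fun u => (weight α β u : ℂ) * g u) (𝓝[region] z) := by
  obtain ⟨C, hC⟩ := hO.bound
  obtain ⟨s, hs, hi⟩ := hh
  obtain ⟨t, ht, hts⟩ := (hC.and (Filter.eventually_of_mem hs fun _ h => h)).exists_mem
  have hr : region ∈ 𝓝[region] z := self_mem_nhdsWithin
  obtain ⟨v, hv, hvz, hvsub⟩ := mem_nhdsWithin.1 (Filter.inter_mem ht hr)
  refine ⟨v ∩ region, inter_mem (mem_nhdsWithin_of_mem_nhds (hv.mem_nhds hvz)) hr, ?_⟩
  have hm : MeasurableSet (v ∩ region) := hv.measurableSet.inter isClosed_region.measurableSet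
  have hsub : v ∩ region ⊆ s := fun u hu => (hts u (hvsub hu).1).2
  refine Integrable.mono' ((hi.mono_set hsub).norm.const_mul C) ?_ ?_
  · exact (((measurable_weight α β).complex_ofReal).aestronglyMeasurable).mul
      ((hg.mono inter_subset_right).aestronglyMeasurable hm)
  · refine (ae_restrict_iff' hm).2 (Eventually.of_forall fun u hu => ?_)
    have h1 := (hts u (hvsub hu).1).1
    have h2 := abs_nonneg (weight α β u)
    simp only [norm_mul, Complex.norm_real, Real.norm_eq_abs] at h1 ⊢
    nlinarith

/-- If the weight is not integrable near a point, square integrable continuous functions vanish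
there. -/
lemma SqIntegrable.eq_zero {α β : ℝ} {g : ℝ × ℝ → ℂ} {z : ℝ × ℝ} (hz : z ∈ region)
    (hg : ContinuousOn g region) (hs : SqIntegrable α β g)
    (hw : ¬ IntegrableAtFilter (weight α β) (𝓝[region] z)) : g z = 0 := by
  by_contra hne
  apply hw
  have hpos : 0 < ‖g z‖ ^ 2 / 2 := by positivity
  have hev : ∀ᶠ u in 𝓝[region] z, ‖g z‖ ^ 2 / 2 < ‖g u‖ ^ 2 :=
    ((hg z hz).norm.pow 2).eventually_const_lt (by simp; positivity)
  obtain ⟨t, ht, hts⟩ := hev.exists_mem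
  have hr : region ∈ 𝓝[region] z := self_mem_nhdsWithin
  obtain ⟨v, hv, hvz, hvsub⟩ := mem_nhdsWithin.1 (Filter.inter_mem ht hr)
  refine ⟨v ∩ region, inter_mem (mem_nhdsWithin_of_mem_nhds (hv.mem_nhds hvz)) hr, ?_⟩
  have hm : MeasurableSet (v ∩ region) := hv.measurableSet.inter isClosed_region.measurableSet
  refine Integrable.mono' ((hs.mono_set inter_subset_right).const_mul (‖g z‖ ^ 2 / 2)⁻¹)
    (measurable_weight α β).aestronglyMeasurable ?_
  refine (ae_restrict_iff' hm).2 (Eventually.of_forall fun u hu => ?_)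
  have h1 := hts u (hvsub hu).1
  have h2 : 0 ≤ weight α β u := weight_nonneg hu.2
  rw [Real.norm_eq_abs, abs_of_nonneg h2, ← mul_assoc]
  have : 1 ≤ (‖g z‖ ^ 2 / 2)⁻¹ * ‖g u‖ ^ 2 := by
    rw [inv_mul_eq_div, one_le_div hpos]; exact h1.le
  nlinarith

/-- Division of the integrable majorant by a factor that does not vanish at the point. -/
lemma integrableAtFilter_weight_mul_of_ne {α β : ℝ} (hα : -1 < α) (hβ : -1 < β)
    {z : ℝ × ℝ} {h : ℝ × ℝ → ℝ} {k : ℕ} (hk : -1 < 3 * (α + β + 1) + k) {c : ℝ × ℝ → ℝ}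
    (hh : Continuous h) (hc : Continuous c) (hcz : c z ≠ 0)
    (hhc : ∀ u, (2 * u.1 + 1) * (1 - u.1) ^ k = c u * h u) :
    IntegrableAtFilter (fun u => weight α β u * h u) (𝓝[region] z) := by
  have hI := integrableOn_weight_mul hα hβ hk
  have hpos : 0 < ‖c z‖ / 2 := by positivity
  have hev : ∀ᶠ u in 𝓝 z, ‖c z‖ / 2 < ‖c u‖ :=
    hc.norm.continuousAt.eventually_const_lt (by linarith)
  obtain ⟨v, hvsub, hv, hvz⟩ := mem_nhds_iff.1 hev
  refine ⟨v ∩ region, inter_mem (mem_nhdsWithin_of_mem_nhds (hv.mem_nhds hvz))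
    self_mem_nhdsWithin, ?_⟩
  have hm : MeasurableSet (v ∩ region) := hv.measurableSet.inter isClosed_region.measurableSet
  refine Integrable.mono' ((hI.mono_set inter_subset_right).norm.const_mul (‖c z‖ / 2)⁻¹)
    ((measurable_weight α β).mul hh.measurable).aestronglyMeasurable ?_
  refine (ae_restrict_iff' hm).2 (Eventually.of_forall fun u hu => ?_)
  have h1 : ‖c z‖ / 2 < ‖c u‖ := hvsub hu.1
  rw [hhc, show weight α β u * (c u * h u) = c u * (weight α β u * h u) by ring, norm_mul (c u),
    ← mul_assoc]
  have : 1 ≤ (‖c z‖ / 2)⁻¹ * ‖c u‖ := by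
    rw [inv_mul_eq_div, one_le_div hpos]; exact h1.le
  nlinarith [norm_nonneg (weight α β u * h u)]

lemma isBigO_sub_of_contDiffAt {g : ℝ × ℝ → ℂ} {z : ℝ × ℝ} (hg : ContDiffAt ℝ 2 g z)
    (h0 : g z = 0) : g =O[𝓝[region] z] fun u => u - z := by
  have := (hg.differentiableAt (by norm_num)).isBigO_sub
  simp only [h0, sub_zero] at this
  exact this.mono nhdsWithin_le_nhds

lemma isBigO_cusp {g : ℝ × ℝ → ℂ} (hg : ContDiffAt ℝ 2 g (-1 / 2, 1)) (h0 : g (-1 / 2, 1) = 0) :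
    g =O[𝓝[region] (-1 / 2, 1)] fun u => 2 * u.1 + 1 := by
  refine (isBigO_sub_of_contDiffAt hg h0).trans ?_
  refine IsBigO.of_bound 6 (eventually_mem_nhdsWithin.mono fun u hu => ?_)
  rw [Real.norm_eq_abs]
  exact (norm_sub_cusp_le hu).trans (by gcongr; exact le_abs_self _)

lemma isBigO_horn_sub : (fun u : ℝ × ℝ => u - (1, 1)) =O[𝓝[region] (1, 1)] fun u => 1 - u.1 := by
  refine IsBigO.of_bound 8 (eventually_mem_nhdsWithin.mono fun u hu => ?_)
  rw [Real.norm_eq_abs]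
  exact (norm_sub_horn_le hu).trans (by gcongr; exact le_abs_self _)

/-- Second order Taylor estimate. -/
lemma isBigO_taylor {g : ℝ × ℝ → ℂ} {z : ℝ × ℝ} (hg : ContDiffAt ℝ 2 g z) :
    (fun u => g u - g z - fderiv ℝ g z (u - z)) =O[𝓝 z] fun u => ‖u - z‖ ^ 2 := by
  have hd : DifferentiableAt ℝ (fderiv ℝ g) z :=
    (hg.fderiv_right (m := 1) (by norm_num)).differentiableAt (by norm_num)
  obtain ⟨K, hK⟩ := hd.isBigO_sub.bound
  have hdiff : ∀ᶠ u in 𝓝 z, DifferentiableAt ℝ g u :=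
    (hg.eventually (by simp)).mono fun u hu => hu.differentiableAt (by norm_num)
  obtain ⟨r, hr, hball⟩ := Metric.eventually_nhds_iff_ball.1 (hK.and hdiff)
  refine IsBigO.of_bound K ?_
  filter_upwards [Metric.ball_mem_nhds z hr] with u hu
  have hsub : Metric.closedBall z ‖u - z‖ ⊆ Metric.ball z r :=
    Metric.closedBall_subset_ball (by rwa [← dist_eq_norm])
  have hK0 : 0 ≤ K * ‖u - z‖ := (norm_nonneg _).trans (hball u hu).1
  have hKK : ∀ x ∈ Metric.closedBall z ‖u - z‖, ‖fderiv ℝ g x - fderiv ℝ g z‖ ≤ K * ‖u - z‖ := by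
    intro x hx
    refine (hball x (hsub hx)).1.trans ?_
    -- The sign of K is known only when u ≠ z; for u = z the ball is a single point.
    rcases (norm_nonneg (u - z)).eq_or_lt with h | h
    · rw [← h, Metric.closedBall_zero, mem_singleton_iff] at hx
      simp [hx, ← h]
    · have : 0 ≤ K := nonneg_of_mul_nonneg_left hK0 h
      gcongr
      rwa [Metric.mem_closedBall, dist_eq_norm] at hx
  have := (convex_closedBall z ‖u - z‖).norm_image_sub_le_of_norm_hasFDerivWithin_le'
    (fun x hx => (hball x (hsub hx)).2.hasFDerivAt.hasFDerivWithinAt) hKK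
    (Metric.mem_closedBall_self (norm_nonneg _))
    (by rw [Metric.mem_closedBall, dist_eq_norm] : u ∈ Metric.closedBall z ‖u - z‖)
  refine this.trans (le_of_eq ?_)
  rw [norm_pow, norm_norm]; ring

/-- The linear Taylor term vanishes along the axis (1, 3), and points of the horn deviate from that
axis only by O((1 - x)²). -/
lemma isBigO_horn_sq {g : ℝ × ℝ → ℂ} (hg : ContDiffAt ℝ 2 g (1, 1)) (h0 : g (1, 1) = 0)
    (h1 : fderiv ℝ g (1, 1) (1, 3) = 0) :
    g =O[𝓝[region] (1, 1)] fun u => (1 - u.1) ^ 2 := by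
  have hT := (isBigO_taylor hg).mono (nhdsWithin_le_nhds (s := region))
  have hT' : (fun u => g u - g (1, 1) - fderiv ℝ g (1, 1) (u - (1, 1))) =O[𝓝[region] (1, 1)]
      fun u => (1 - u.1) ^ 2 := hT.trans (isBigO_horn_sub.norm_left.pow 2)
  have hD : (fun u : ℝ × ℝ => fderiv ℝ g (1, 1) (u - (1, 1))) =O[𝓝[region] (1, 1)]
      fun u => (1 - u.1) ^ 2 := by
    refine IsBigO.of_bound (3 * ‖fderiv ℝ g (1, 1) (0, 1)‖)
      (eventually_mem_nhdsWithin.mono fun u hu => ?_)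
    have e : u - (1, 1) = (u.1 - 1) • ((1, 3) : ℝ × ℝ) +
        (u.2 - 1 - 3 * (u.1 - 1)) • ((0, 1) : ℝ × ℝ) := by
      ext
      · simp
      · simp; ring
    rw [e, map_add, map_smul, map_smul, h1, smul_zero, zero_add, norm_smul, Real.norm_eq_abs,
      Real.norm_eq_abs, abs_of_nonneg (sq_nonneg (1 - u.1))]
    have := abs_sub_tangent_le hu
    nlinarith [norm_nonneg (fderiv ℝ g (1, 1) (0, 1))]
  refine (hT'.add hD).congr_left fun u => ?_
  rw [h0]; ring

/-- All entries of Λ vanish at (1, 1), so only first-order terms survive, and each of them is a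
multiple of ∂ₓ + 3∂_y, the derivative along the axis of the horn. -/
lemma polyL_horn (α β : ℝ) (f : ℝ × ℝ → ℂ) :
    polyL α β f (1, 1) = -((24 + 18 * (α + β) : ℝ) : ℂ) * fderiv ℝ f (1, 1) (1, 3) := by
  have e : fderiv ℝ f (1, 1) (1, 3) = dx f (1, 1) + 3 * dy f (1, 1) := by
    have : ((1, 3) : ℝ × ℝ) = (1, 0) + (3 : ℝ) • (0, 1) := by ext <;> simp
    rw [this, map_add, map_smul, dx, dy]
    simp
  rw [e]
  simp only [polyL, conormalP, conormalQ, A₁₁, A₁₂, A₂₂]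
  push_cast
  ring

/-- A function in the domain of `L` is integrable with respect to the weight, even if the weight
has infinite mass. -/
lemma InDomain.integrableOn_weight_mul {α β : ℝ} (hα : -1 < α) (hβ : -1 < β) {g : ℝ × ℝ → ℂ}
    (hg : InDomain α β g) : IntegrableOn (fun z => (weight α β z : ℂ) * g z) region := by
  have hgc := hg.isC2.continuousOn
  -- Since α + β > -2, two powers of 1 - x always suffice at the horn.
  have hk2 : -1 < 3 * (α + β + 1) + (2 : ℕ) := by push_cast; linarith
  have hone : ∀ z ∈ region, g =O[𝓝[region] z] fun _ => (1 : ℝ) := fun z hz =>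
    (hgc z hz).isBigO_one ℝ
  refine LocallyIntegrableOn.integrableOn_isCompact (fun z hz => ?_) isCompact_region
  by_cases hw : IntegrableAtFilter (weight α β) (𝓝[region] z)
  · exact integrableAtFilter_weight_mul_of_isBigO hgc (hone z hz) (by simpa using hw)
  have hgz : g z = 0 := hg.sqIntegrable.eq_zero hz hgc hw
  by_cases hA : 2 * z.1 + 1 = 0
  · obtain rfl := eq_cusp_of_fst hz hA
    refine integrableAtFilter_weight_mul_of_isBigO hgc (isBigO_cusp (hg.isC2 _ hz) hgz) ?_
    refine integrableAtFilter_weight_mul_of_ne hα hβ hk2 (c := fun u => (1 - u.1) ^ 2)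
      (by fun_prop) (by fun_prop) (by norm_num) fun u => by ring
  by_cases hB : 1 - z.1 = 0
  · obtain rfl := eq_horn_of_fst hz hB
    -- This is the range in which one power suffices: 3(α + β + 1) + 1 > -1. Outside it 24 + 18(α +
    -- β) ≤ -6 is nonzero, so the vanishing of L g at the horn yields a second power.
    by_cases hab : -5 / 3 < α + β
    · have hO := (isBigO_sub_of_contDiffAt (hg.isC2 _ hz) hgz).trans isBigO_horn_sub
      refine integrableAtFilter_weight_mul_of_isBigO hgc hO ?_
      refine integrableAtFilter_weight_mul_of_ne hα hβ (k := 1) (by push_cast; linarith)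
        (c := fun u => 2 * u.1 + 1) (by fun_prop) (by fun_prop) (by norm_num) fun u => by ring
    · have hL : SqIntegrable α β (fun z => -polyL α β g z) := by
        refine hg.sqIntegrable_L.congr_fun_ae ?_
        filter_upwards [hg.isC2.L_ae_eq α β] with u hu
        rw [hu]
      have h0 := hL.eq_zero hz (hg.isC2.continuousOn_polyL α β).neg hw
      rw [Pi.neg_apply, polyL_horn] at h0
      have hne : ((24 + 18 * (α + β) : ℝ) : ℂ) ≠ 0 := by
        have : (24 + 18 * (α + β) : ℝ) ≠ 0 := by linarith
        exact_mod_cast this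
      have h1 : fderiv ℝ g (1, 1) (1, 3) = 0 :=
        (mul_eq_zero.1 (neg_eq_zero.1 h0)).resolve_left (neg_ne_zero.2 hne)
      refine integrableAtFilter_weight_mul_of_isBigO hgc (isBigO_horn_sq (hg.isC2 _ hz) hgz h1) ?_
      refine integrableAtFilter_weight_mul_of_ne hα hβ hk2
        (c := fun u => 2 * u.1 + 1) (by fun_prop) (by fun_prop) (by norm_num) fun u => by ring
  -- Away from the two vertices the damping factor is nonzero and can be divided out.
  · refine integrableAtFilter_weight_mul_of_isBigO hgc (hone z hz) ?_
    refine integrableAtFilter_weight_mul_of_ne hα hβ hk2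
      (c := fun u => (2 * u.1 + 1) * (1 - u.1) ^ 2) (by fun_prop) (by fun_prop) ?_
      fun u => by ring
    exact mul_ne_zero hA (pow_ne_zero _ hB)

/-! ### Cutoff functions. -/

/-- A smooth ramp, `0` on `(-∞, 1]` and `1` on `[2, ∞)`. -/
def ramp (r : ℝ) : ℝ := Real.smoothTransition (r - 1)

lemma contDiff_ramp : ContDiff ℝ 1 ramp :=
  Real.smoothTransition.contDiff.comp (contDiff_id.sub contDiff_const)

lemma ramp_of_le {r : ℝ} (h : r ≤ 1) : ramp r = 0 :=
  Real.smoothTransition.zero_of_nonpos (by linarith)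

lemma ramp_of_ge {r : ℝ} (h : 2 ≤ r) : ramp r = 1 :=
  Real.smoothTransition.one_of_one_le (by linarith)

lemma ramp_nonneg (r : ℝ) : 0 ≤ ramp r := Real.smoothTransition.nonneg _

lemma ramp_le_one (r : ℝ) : ramp r ≤ 1 := Real.smoothTransition.le_one _

/-- The Euler derivative `r ramp'(r)` of the ramp. -/
def rampEuler (r : ℝ) : ℝ := r * deriv ramp r

lemma continuous_rampEuler : Continuous rampEuler :=
  continuous_id.mul (contDiff_ramp.continuous_deriv le_rfl)

lemma rampEuler_of_lt {r : ℝ} (h : r < 1) : rampEuler r = 0 := by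
  have : ramp =ᶠ[𝓝 r] fun _ => 0 := (eventually_lt_nhds h).mono fun s hs => ramp_of_le hs.le
  rw [rampEuler, this.deriv_eq, deriv_const, mul_zero]

lemma rampEuler_of_gt {r : ℝ} (h : 2 < r) : rampEuler r = 0 := by
  have : ramp =ᶠ[𝓝 r] fun _ => 1 := (eventually_gt_nhds h).mono fun s hs => ramp_of_ge hs.le
  rw [rampEuler, this.deriv_eq, deriv_const, mul_zero]

lemma exists_abs_rampEuler_le : ∃ C : ℝ, 0 ≤ C ∧ ∀ r, |rampEuler r| ≤ C := by
  obtain ⟨C, hC⟩ := isCompact_Icc.exists_bound_of_continuousOn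
    (continuous_rampEuler.continuousOn (s := Icc 1 2))
  refine ⟨max C 0, le_max_right _ _, fun r => ?_⟩
  by_cases h1 : r < 1
  · simp [rampEuler_of_lt h1]
  by_cases h2 : 2 < r
  · simp [rampEuler_of_gt h2]
  exact (hC r ⟨not_lt.1 h1, not_lt.1 h2⟩).trans (le_max_left _ _)

/-- Cutoff functions supported inside the triangle. -/
def cutoff (n : ℕ) (z : ℝ × ℝ) : ℝ := ramp ((n + 1) * p z) * ramp ((n + 1) * q z)

lemma contDiff_cutoff (n : ℕ) : ContDiff ℝ 1 (cutoff n) := by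
  have hp : ContDiff ℝ 1 p := by unfold p; fun_prop
  have hq : ContDiff ℝ 1 q := by unfold q; fun_prop
  exact (contDiff_ramp.comp (contDiff_const.mul hp)).mul
    (contDiff_ramp.comp (contDiff_const.mul hq))

lemma cutoff_nonneg (n : ℕ) (z : ℝ × ℝ) : 0 ≤ cutoff n z :=
  mul_nonneg (ramp_nonneg _) (ramp_nonneg _)

lemma cutoff_le_one (n : ℕ) (z : ℝ × ℝ) : cutoff n z ≤ 1 :=
  mul_le_one₀ (ramp_le_one _) (ramp_nonneg _) (ramp_le_one _)

/-- The ramp stays 0 up to argument 1, so the cutoff vanishes on a whole neighbourhood of each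
boundary point; multiplying by it makes the singular weight C¹ on the plane. -/
lemma cutoff_eventuallyEq_zero (n : ℕ) {z : ℝ × ℝ} (hz : z ∉ interiorRegion) :
    cutoff n =ᶠ[𝓝 z] fun _ => 0 := by
  have hor : p z ≤ 0 ∨ q z ≤ 0 := by
    by_contra! h
    exact hz h
  rcases hor with h | h
  · have hc : ContinuousAt (fun u => ((n : ℝ) + 1) * p u) z :=
      (continuous_const.mul continuous_p).continuousAt
    have : ((n : ℝ) + 1) * p z < 1 := by
      have : ((n : ℝ) + 1) * p z ≤ 0 := mul_nonpos_of_nonneg_of_nonpos (by positivity) h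
      linarith
    filter_upwards [hc.eventually_lt_const this] with u hu
    rw [cutoff, ramp_of_le hu.le, zero_mul]
  · have hc : ContinuousAt (fun u => ((n : ℝ) + 1) * q u) z :=
      (continuous_const.mul continuous_q).continuousAt
    have : ((n : ℝ) + 1) * q z < 1 := by
      have : ((n : ℝ) + 1) * q z ≤ 0 := mul_nonpos_of_nonneg_of_nonpos (by positivity) h
      linarith
    filter_upwards [hc.eventually_lt_const this] with u hu
    rw [cutoff, ramp_of_le hu.le, mul_zero]

lemma eventually_lt_succ_mul {s : ℝ} (hs : 0 < s) (c : ℝ) :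
    ∀ᶠ n : ℕ in atTop, c < ((n : ℝ) + 1) * s :=
  ((tendsto_natCast_atTop_atTop.atTop_add tendsto_const_nhds).atTop_mul_const hs).eventually_gt_atTop c

lemma cutoff_eventually_eq_one {z : ℝ × ℝ} (hz : z ∈ interiorRegion) :
    ∀ᶠ n : ℕ in atTop, cutoff n z = 1 := by
  filter_upwards [eventually_lt_succ_mul hz.1 2, eventually_lt_succ_mul hz.2 2] with n h1 h2
  rw [cutoff, ramp_of_ge h1.le, ramp_of_ge h2.le, one_mul]

/-- `∇χ · Λ∇f` for the cutoff function `χ`. -/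
def cutoffFlux (n : ℕ) (f : ℝ × ℝ → ℂ) (z : ℝ × ℝ) : ℂ :=
  (rampEuler ((n + 1) * p z) * ramp ((n + 1) * q z) : ℝ) * conormalP f z +
    (ramp ((n + 1) * p z) * rampEuler ((n + 1) * q z) : ℝ) * conormalQ f z

/-- The chain rule produces (n+1)·ramp'((n+1)p), and `flux_p` supplies the missing factor p. The
result is the Euler derivative of the ramp, which is bounded independently of n; likewise for q. -/
lemma cutoff_flux (n : ℕ) (f : ℝ × ℝ → ℂ) (z : ℝ × ℝ) :
    (fderiv ℝ (cutoff n) z (1, 0) : ℂ) * flux₁ f z +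
      (fderiv ℝ (cutoff n) z (0, 1) : ℂ) * flux₂ f z = cutoffFlux n f z := by
  have hr : ∀ r, HasDerivAt ramp (deriv ramp r) r := fun r =>
    (contDiff_ramp.differentiable (by norm_num) r).hasDerivAt
  have hp := ((hasFDerivAt_p z).differentiableAt.hasFDerivAt).const_mul ((n : ℝ) + 1)
  have hq := ((hasFDerivAt_q z).differentiableAt.hasFDerivAt).const_mul ((n : ℝ) + 1)
  have h : HasFDerivAt (cutoff n) _ z :=
    ((hr _).comp_hasFDerivAt z hp).mul ((hr _).comp_hasFDerivAt z hq)
  rw [h.fderiv]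
  have e1 := flux_p f z
  have e2 := flux_q f z
  simp only [cutoffFlux, rampEuler, add_apply, smul_apply, smul_eq_mul, Function.comp_apply]
  push_cast
  linear_combination (deriv ramp ((n + 1) * p z) * (n + 1) * ramp ((n + 1) * q z) : ℂ) * e1 +
    (deriv ramp ((n + 1) * q z) * (n + 1) * ramp ((n + 1) * p z) : ℂ) * e2

lemma cutoffFlux_eventually_eq_zero (f : ℝ × ℝ → ℂ) {z : ℝ × ℝ} (hz : z ∈ interiorRegion) :
    ∀ᶠ n : ℕ in atTop, cutoffFlux n f z = 0 := by
  filter_upwards [eventually_lt_succ_mul hz.1 2, eventually_lt_succ_mul hz.2 2] with n h1 h2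
  simp [cutoffFlux, rampEuler_of_gt h1, rampEuler_of_gt h2]

/-! ### Green's formula. -/

/-- The integral of a derivative of a compactly supported function vanishes. -/
lemma integral_fderiv_eq_zero {G : ℝ × ℝ → ℂ} (hG : ContDiff ℝ 1 G) (hc : HasCompactSupport G)
    (v : ℝ × ℝ) : Integrable (fun z => fderiv ℝ G z v) ∧ ∫ z, fderiv ℝ G z v = 0 := by
  have hi : Integrable (fun z => fderiv ℝ G z v) :=
    ((hG.continuous_fderiv (by norm_num)).clm_apply continuous_const).integrable_of_hasCompactSupport
      (hc.fderiv_apply ℝ v)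
  refine ⟨hi, ?_⟩
  -- Integration by parts against the constant function 1.
  have := integral_smul_fderiv_eq_neg_fderiv_smul_of_integrable (𝕜 := ℝ) (μ := volume)
    (f := fun _ : ℝ × ℝ => (1 : ℝ)) (g := G) (v := v) (by simp) (by simpa using hi)
    (by simpa using hG.continuous.integrable_of_hasCompactSupport hc)
    (fun z _ => differentiableAt_const _) (fun z _ => hG.differentiable (by norm_num) z)
  simpa using this

/-- The density of the Dirichlet form. -/
def dirichlet (f g : ℝ × ℝ → ℂ) (z : ℝ × ℝ) : ℂ :=
  flux₁ f z * conj (dx g z) + flux₂ f z * conj (dy g z)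

lemma contDiffAt_conj {g : ℝ × ℝ → ℂ} {z : ℝ × ℝ} {n : WithTop ℕ∞} (hg : ContDiffAt ℝ n g z) :
    ContDiffAt ℝ n (fun u => conj (g u)) z :=
  Complex.conjCLE.contDiff.contDiffAt.comp z hg

lemma fderiv_conj_apply {g : ℝ × ℝ → ℂ} {z : ℝ × ℝ} (hg : DifferentiableAt ℝ g z) (v : ℝ × ℝ) :
    fderiv ℝ (fun u => conj (g u)) z v = conj (fderiv ℝ g z v) := by
  have h : HasFDerivAt (fun u => conj (g u))
      ((Complex.conjCLE : ℂ →L[ℝ] ℂ).comp (fderiv ℝ g z)) z :=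
    (Complex.conjCLE : ℂ →L[ℝ] ℂ).hasFDerivAt.comp z hg.hasFDerivAt
  rw [h.fderiv]
  simp

lemma fderiv_cutoff_mul {n : ℕ} {g W : ℝ × ℝ → ℂ} {z : ℝ × ℝ} (hg : DifferentiableAt ℝ g z)
    (hW : DifferentiableAt ℝ W z) (v : ℝ × ℝ) :
    fderiv ℝ (fun u => (cutoff n u : ℂ) * (conj (g u) * W u)) z v =
      cutoff n z * (conj (g z) * fderiv ℝ W z v + conj (fderiv ℝ g z v) * W z) +
        (fderiv ℝ (cutoff n) z v : ℂ) * (conj (g z) * W z) := by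
  have hgc : DifferentiableAt ℝ (fun u => conj (g u)) z :=
    (Complex.conjCLE : ℂ →L[ℝ] ℂ).differentiableAt.comp z hg
  have hd : DifferentiableAt ℝ (fun u => conj (g u) * W u) z := hgc.mul hW
  rw [fderiv_ofReal_mul ((contDiff_cutoff n).differentiable (by norm_num) z) hd]
  have h : HasFDerivAt (fun u => conj (g u) * W u) _ z := hgc.hasFDerivAt.mul hW.hasFDerivAt
  rw [h.fderiv]
  simp only [add_apply, smul_apply, smul_eq_mul, fderiv_conj_apply hg]
  ring

lemma contDiff_cutoff_mul {α β : ℝ} (n : ℕ) {g F : ℝ × ℝ → ℂ}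
    (hg : ∀ z ∈ region, ContDiffAt ℝ 1 g z) (hF : ∀ z ∈ region, ContDiffAt ℝ 1 F z) :
    ContDiff ℝ 1 (fun u => (cutoff n u : ℂ) * (conj (g u) * ((weight α β u : ℂ) * F u))) ∧
    HasCompactSupport
      (fun u => (cutoff n u : ℂ) * (conj (g u) * ((weight α β u : ℂ) * F u))) := by
  constructor
  · rw [contDiff_iff_contDiffAt]
    intro z
    by_cases hz : z ∈ interiorRegion
    · have hr := interiorRegion_subset hz
      exact (Complex.ofRealCLM.contDiff.comp (contDiff_cutoff n)).contDiffAt.mul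
        ((contDiffAt_conj (hg z hr)).mul ((contDiffAt_weight hz).mul (hF z hr)))
    · refine (contDiffAt_const (c := (0 : ℂ))).congr_of_eventuallyEq ?_
      filter_upwards [cutoff_eventuallyEq_zero n hz] with u hu
      simp [hu]
  · refine HasCompactSupport.intro isCompact_region fun z hz => ?_
    have := (cutoff_eventuallyEq_zero n fun h => hz (interiorRegion_subset h)).self_of_nhds
    simp [this]

/-- Divergence form of the product of `L f` with a cutoff and a test function. -/
lemma div_cutoff_eq {α β : ℝ} (n : ℕ) {f g : ℝ × ℝ → ℂ} {z : ℝ × ℝ} (hz : z ∈ interiorRegion)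
    (hf : ContDiffAt ℝ 2 f z) (hg : ContDiffAt ℝ 2 g z) :
    dx (fun u => (cutoff n u : ℂ) * (conj (g u) * ((weight α β u : ℂ) * flux₁ f u))) z +
      dy (fun u => (cutoff n u : ℂ) * (conj (g u) * ((weight α β u : ℂ) * flux₂ f u))) z =
    -((cutoff n z : ℂ) * (L α β f z * conj (g z) * weight α β z)) +
      (cutoff n z : ℂ) * (dirichlet f g z * weight α β z) +
      cutoffFlux n f z * (weight α β z * conj (g z)) := by
  have hg' := hg.differentiableAt (by norm_num)
  have hw := contDiffAt_weight (α := α) (β := β) hz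
  have h1 : DifferentiableAt ℝ (fun u => (weight α β u : ℂ) * flux₁ f u) z :=
    (hw.mul (contDiffAt_flux₁ hf)).differentiableAt (by norm_num)
  have h2 : DifferentiableAt ℝ (fun u => (weight α β u : ℂ) * flux₂ f u) z :=
    (hw.mul (contDiffAt_flux₂ hf)).differentiableAt (by norm_num)
  have e1 := fderiv_cutoff_mul (n := n) hg' h1 (1, 0)
  have e2 := fderiv_cutoff_mul (n := n) hg' h2 (0, 1)
  have e3 := weight_mul_L (α := α) (β := β) hz f
  have e4 := cutoff_flux n f z
  simp only [dirichlet]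
  simp only [dx, dy] at e1 e2 e3 e4 ⊢
  rw [e1, e2, ← e4]
  linear_combination (cutoff n z : ℂ) * conj (g z) * e3

lemma ae_region_mem_interiorRegion :
    ∀ᵐ z ∂(volume.restrict region : Measure (ℝ × ℝ)), z ∈ interiorRegion := by
  rw [← restrict_interiorRegion]
  exact ae_restrict_mem isOpen_interiorRegion.measurableSet

lemma integrableOn_mul_of_continuousOn {E F : ℝ × ℝ → ℂ} (hE : IntegrableOn E region)
    (hF : ContinuousOn F region) : IntegrableOn (fun z => F z * E z) region := by
  obtain ⟨C, hC⟩ := isCompact_region.exists_bound_of_continuousOn hF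
  refine Integrable.mono' (hE.norm.const_mul C)
    ((hF.aestronglyMeasurable isClosed_region.measurableSet).mul hE.aestronglyMeasurable) ?_
  refine (ae_restrict_iff' isClosed_region.measurableSet).2 (Eventually.of_forall fun z hz => ?_)
  rw [norm_mul]
  exact mul_le_mul_of_nonneg_right (hC z hz) (norm_nonneg _)

lemma InDomain.integrableOn_weight_mul_conj {α β : ℝ} (hα : -1 < α) (hβ : -1 < β)
    {g : ℝ × ℝ → ℂ} (hg : InDomain α β g) :
    IntegrableOn (fun z => (weight α β z : ℂ) * conj (g z)) region := by
  have h := hg.integrableOn_weight_mul hα hβ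
  have h2 := (Complex.conjCLE : ℂ →L[ℝ] ℂ).integrable_comp h
  simpa [IntegrableOn] using h2

/-- L f agrees almost everywhere with a function continuous on the compact triangle, hence is
essentially bounded; integrability comes from w·g. -/
lemma InDomain.integrableOn_L_mul {α β : ℝ} (hα : -1 < α) (hβ : -1 < β) {f g : ℝ × ℝ → ℂ}
    (hf : IsC2 f) (hg : InDomain α β g) :
    IntegrableOn (fun z => L α β f z * conj (g z) * (weight α β z : ℂ)) region := by
  have h := integrableOn_mul_of_continuousOn (hg.integrableOn_weight_mul_conj hα hβ)
    (hf.continuousOn_polyL α β).neg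
  refine h.congr ?_
  filter_upwards [hf.L_ae_eq α β] with z hz
  rw [hz, Pi.neg_apply]; ring

lemma InDomain.integrableOn_mul_L {α β : ℝ} (hα : -1 < α) (hβ : -1 < β) {f g : ℝ × ℝ → ℂ}
    (hf : InDomain α β f) (hg : IsC2 g) :
    IntegrableOn (fun z => f z * conj (L α β g z) * (weight α β z : ℂ)) region := by
  have h := (Complex.conjCLE : ℂ →L[ℝ] ℂ).integrable_comp (hf.integrableOn_L_mul hα hβ hg)
  refine h.congr (Eventually.of_forall fun z => ?_)
  change conj (L α β g z * conj (f z) * (weight α β z : ℂ)) = _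
  simp only [map_mul, Complex.conj_conj, Complex.conj_ofReal]
  ring

lemma continuousOn_conormal {f : ℝ × ℝ → ℂ} (hf : IsC2 f) :
    ContinuousOn (conormalP f) region ∧ ContinuousOn (conormalQ f) region := by
  have h1 := hf.continuousOn_dx
  have h2 := hf.continuousOn_dy
  unfold conormalP conormalQ
  constructor <;> fun_prop

lemma continuous_cutoffFlux_coeffs (n : ℕ) :
    Continuous (fun z => rampEuler ((n + 1) * p z) * ramp ((n + 1) * q z)) ∧
    Continuous (fun z => ramp ((n + 1) * p z) * rampEuler ((n + 1) * q z)) := by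
  have h1 := continuous_p
  have h2 := continuous_q
  have h3 := contDiff_ramp.continuous
  have h4 := continuous_rampEuler
  constructor <;> fun_prop

/-- The terms produced by differentiating the cutoff functions vanish in the limit. -/
lemma tendsto_cutoffFlux {f E : ℝ × ℝ → ℂ} (hf : IsC2 f) (hE : IntegrableOn E region) :
    (∀ n, IntegrableOn (fun z => cutoffFlux n f z * E z) region) ∧
    Tendsto (fun n => ∫ z in region, cutoffFlux n f z * E z) atTop (𝓝 0) := by
  obtain ⟨hP, hQ⟩ := continuousOn_conormal hf
  have hcont : ∀ n, ContinuousOn (cutoffFlux n f) region := by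
    intro n
    obtain ⟨h1, h2⟩ := continuous_cutoffFlux_coeffs n
    exact ((Complex.continuous_ofReal.comp h1).continuousOn.mul hP).add
      ((Complex.continuous_ofReal.comp h2).continuousOn.mul hQ)
  have hint : ∀ n, IntegrableOn (fun z => cutoffFlux n f z * E z) region := fun n =>
    integrableOn_mul_of_continuousOn hE (hcont n)
  refine ⟨hint, ?_⟩
  obtain ⟨C, hC0, hC⟩ := exists_abs_rampEuler_le
  obtain ⟨D₁, hD₁⟩ := isCompact_region.exists_bound_of_continuousOn hP
  obtain ⟨D₂, hD₂⟩ := isCompact_region.exists_bound_of_continuousOn hQ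
  rw [show (0 : ℂ) = ∫ z in region, (0 : ℂ) by simp]
  refine tendsto_integral_of_dominated_convergence (fun z => (C * D₁ + C * D₂) * ‖E z‖)
    (fun n => (hint n).aestronglyMeasurable) (hE.norm.const_mul _) (fun n => ?_) ?_
  · refine (ae_restrict_iff' isClosed_region.measurableSet).2
      (Eventually.of_forall fun z hz => ?_)
    rw [norm_mul]
    refine mul_le_mul_of_nonneg_right ?_ (norm_nonneg _)
    refine (norm_add_le _ _).trans (add_le_add ?_ ?_)
    · rw [norm_mul, Complex.norm_real, Real.norm_eq_abs, abs_mul, abs_of_nonneg (ramp_nonneg _)]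
      refine mul_le_mul ?_ (hD₁ z hz) (norm_nonneg _) hC0
      exact (mul_le_of_le_one_right (abs_nonneg _) (ramp_le_one _)).trans (hC _)
    · rw [norm_mul, Complex.norm_real, Real.norm_eq_abs, abs_mul, abs_of_nonneg (ramp_nonneg _)]
      refine mul_le_mul ?_ (hD₂ z hz) (norm_nonneg _) hC0
      exact (mul_le_of_le_one_left (abs_nonneg _) (ramp_le_one _)).trans (hC _)
  · filter_upwards [ae_region_mem_interiorRegion] with z hz
    refine tendsto_const_nhds.congr' ?_
    filter_upwards [cutoffFlux_eventually_eq_zero f hz] with n hn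
    rw [hn, zero_mul]

lemma tendsto_cutoff_mul {E : ℝ × ℝ → ℂ} (hE : IntegrableOn E region) :
    (∀ n, IntegrableOn (fun z => (cutoff n z : ℂ) * E z) region) ∧
    Tendsto (fun n => ∫ z in region, (cutoff n z : ℂ) * E z) atTop (𝓝 (∫ z in region, E z)) := by
  have hint : ∀ n, IntegrableOn (fun z => (cutoff n z : ℂ) * E z) region := fun n =>
    integrableOn_mul_of_continuousOn hE
      (Complex.continuous_ofReal.comp (contDiff_cutoff n).continuous).continuousOn
  refine ⟨hint, ?_⟩
  refine tendsto_integral_of_dominated_convergence (fun z => ‖E z‖)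
    (fun n => (hint n).aestronglyMeasurable) hE.norm (fun n => ?_) ?_
  · refine Eventually.of_forall fun z => ?_
    rw [norm_mul, Complex.norm_real, Real.norm_eq_abs, abs_of_nonneg (cutoff_nonneg _ _)]
    exact mul_le_of_le_one_left (norm_nonneg _) (cutoff_le_one _ _)
  · filter_upwards [ae_region_mem_interiorRegion] with z hz
    refine tendsto_const_nhds.congr' ?_
    filter_upwards [cutoff_eventually_eq_one hz] with n hn
    rw [hn]; simp

lemma setIntegral_fderiv_cutoff_mul {α β : ℝ} (n : ℕ) {g F : ℝ × ℝ → ℂ}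
    (hg : ∀ z ∈ region, ContDiffAt ℝ 1 g z) (hF : ∀ z ∈ region, ContDiffAt ℝ 1 F z)
    (v : ℝ × ℝ) :
    IntegrableOn (fun z => fderiv ℝ
      (fun u => (cutoff n u : ℂ) * (conj (g u) * ((weight α β u : ℂ) * F u))) z v) region ∧
    ∫ z in region, fderiv ℝ
      (fun u => (cutoff n u : ℂ) * (conj (g u) * ((weight α β u : ℂ) * F u))) z v = 0 := by
  obtain ⟨h1, h2⟩ := contDiff_cutoff_mul (α := α) (β := β) n hg hF
  obtain ⟨h3, h4⟩ := integral_fderiv_eq_zero h1 h2 v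
  refine ⟨h3.integrableOn, ?_⟩
  rw [setIntegral_eq_integral_of_forall_compl_eq_zero, h4]
  intro z hz
  have : (fun u => (cutoff n u : ℂ) * (conj (g u) * ((weight α β u : ℂ) * F u)))
      =ᶠ[𝓝 z] fun _ => 0 := by
    filter_upwards [cutoff_eventuallyEq_zero n fun h => hz (interiorRegion_subset h)] with u hu
    simp [hu]
  rw [this.fderiv_eq]
  simp

/-- Green's formula: the truncated Dirichlet form converges to `∫ L f · conj g · w`. -/
lemma tendsto_dirichlet {α β : ℝ} (hα : -1 < α) (hβ : -1 < β) {f g : ℝ × ℝ → ℂ}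
    (hf : IsC2 f) (hg : InDomain α β g) :
    (∀ n, IntegrableOn (fun z => (cutoff n z : ℂ) * (dirichlet f g z * weight α β z)) region) ∧
    Tendsto (fun n => ∫ z in region, (cutoff n z : ℂ) * (dirichlet f g z * weight α β z)) atTop
      (𝓝 (∫ z in region, L α β f z * conj (g z) * (weight α β z : ℂ))) := by
  obtain ⟨i₁, t₁⟩ := tendsto_cutoffFlux hf (hg.integrableOn_weight_mul_conj hα hβ)
  obtain ⟨i₂, t₂⟩ := tendsto_cutoff_mul (hg.integrableOn_L_mul hα hβ hf)
  -- The cut-off field χ·conj g·w·Λ∇f is C¹ with compact support, so its divergence integrates to 0;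
  -- expanding that divergence gives the identity.
  have key : ∀ n, IntegrableOn
      (fun z => (cutoff n z : ℂ) * (dirichlet f g z * weight α β z)) region ∧
      ∫ z in region, (cutoff n z : ℂ) * (dirichlet f g z * weight α β z) =
        (∫ z in region, (cutoff n z : ℂ) * (L α β f z * conj (g z) * (weight α β z : ℂ))) -
        ∫ z in region, cutoffFlux n f z * (weight α β z * conj (g z)) := by
    intro n
    have hg1 : ∀ z ∈ region, ContDiffAt ℝ 1 g z := fun z hz =>
      (hg.isC2 z hz).of_le (by norm_num)
    obtain ⟨j₁, k₁⟩ := setIntegral_fderiv_cutoff_mul (α := α) (β := β) n hg1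
      (fun z hz => contDiffAt_flux₁ (hf z hz)) (1, 0)
    obtain ⟨j₂, k₂⟩ := setIntegral_fderiv_cutoff_mul (α := α) (β := β) n hg1
      (fun z hz => contDiffAt_flux₂ (hf z hz)) (0, 1)
    have hae : (fun z => (cutoff n z : ℂ) * (dirichlet f g z * weight α β z)) =ᵐ[
        volume.restrict region] fun z =>
        (fderiv ℝ (fun u => (cutoff n u : ℂ) *
          (conj (g u) * ((weight α β u : ℂ) * flux₁ f u))) z (1, 0) +
        fderiv ℝ (fun u => (cutoff n u : ℂ) *
          (conj (g u) * ((weight α β u : ℂ) * flux₂ f u))) z (0, 1)) +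
        ((cutoff n z : ℂ) * (L α β f z * conj (g z) * (weight α β z : ℂ)) -
          cutoffFlux n f z * (weight α β z * conj (g z))) := by
      filter_upwards [ae_region_mem_interiorRegion] with z hz
      have hr := interiorRegion_subset hz
      have := div_cutoff_eq (α := α) (β := β) n hz (hf z hr) (hg.isC2 z hr)
      simp only [dx, dy] at this
      rw [this]; ring
    refine ⟨((j₁.add j₂).add ((i₂ n).sub (i₁ n))).congr hae.symm, ?_⟩
    have e := integral_add j₁ j₂
    rw [k₁, k₂, add_zero] at e
    rw [integral_congr_ae hae, ← integral_sub (i₂ n) (i₁ n)]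
    refine (integral_add (j₁.add j₂) ((i₂ n).sub (i₁ n))).trans ?_
    exact (congrArg₂ (· + ·) e rfl).trans (zero_add _)
  refine ⟨fun n => (key n).1, ?_⟩
  have := t₂.sub t₁
  rw [sub_zero] at this
  exact this.congr fun n => (key n).2.symm

/-! ### Symmetry, positivity and the kernel. -/

/-- Λ is real and symmetric, so the form is Hermitian. -/
lemma conj_dirichlet (f g : ℝ × ℝ → ℂ) (z : ℝ × ℝ) :
    conj (dirichlet g f z) = dirichlet f g z := by
  simp only [dirichlet, flux₁, flux₂, map_add, map_mul, Complex.conj_ofReal, Complex.conj_conj]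
  ring

/-- Symmetry of `L`. -/
lemma integral_L_mul_conj_comm {α β : ℝ} (hα : -1 < α) (hβ : -1 < β) {f g : ℝ × ℝ → ℂ}
    (hf : InDomain α β f) (hg : InDomain α β g) :
    ∫ z in region, L α β f z * conj (g z) * (weight α β z : ℂ) =
      ∫ z in region, f z * conj (L α β g z) * (weight α β z : ℂ) := by
  have h1 := (tendsto_dirichlet hα hβ hf.isC2 hg).2
  have h2 := (Complex.continuous_conj.tendsto _).comp (tendsto_dirichlet hα hβ hg.isC2 hf).2
  rw [← integral_conj] at h2
  have h3 := tendsto_nhds_unique h1 (h2.congr fun n => ?_)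
  · rw [h3]
    refine integral_congr_ae (Eventually.of_forall fun z => ?_)
    simp only [map_mul, Complex.conj_conj, Complex.conj_ofReal]
    ring
  · simp only [Function.comp_apply]
    rw [← integral_conj]
    refine integral_congr_ae (Eventually.of_forall fun z => ?_)
    simp [conj_dirichlet]

lemma dirichlet_self_im (f : ℝ × ℝ → ℂ) (z : ℝ × ℝ) : (dirichlet f f z).im = 0 :=
  Complex.conj_eq_iff_im.1 (conj_dirichlet f f z)

/-- Completing the square in ∂ₓf, separately for real and imaginary parts, leaves det Λ = 9pq as the
coefficient of |∂_y f|². -/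
lemma A₁₁_mul_dirichlet_self_re (f : ℝ × ℝ → ℂ) (z : ℝ × ℝ) :
    A₁₁ z * (dirichlet f f z).re = (A₁₁ z * (dx f z).re + A₁₂ z * (dy f z).re) ^ 2 +
      (A₁₁ z * (dx f z).im + A₁₂ z * (dy f z).im) ^ 2 +
      9 * p z * q z * ((dy f z).re ^ 2 + (dy f z).im ^ 2) := by
  rw [← det_eq]
  simp [dirichlet, flux₁, flux₂]
  ring

lemma dirichlet_self_re_nonneg (f : ℝ × ℝ → ℂ) {z : ℝ × ℝ} (hz : z ∈ interiorRegion) :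
    0 ≤ (dirichlet f f z).re := by
  have h1 := A₁₁_mul_dirichlet_self_re f z
  have h2 : 0 < 9 * p z * q z := mul_pos (mul_pos (by norm_num) hz.1) hz.2
  refine nonneg_of_mul_nonneg_right (a := A₁₁ z) ?_ (A₁₁_pos hz)
  rw [h1]; positivity

lemma fderiv_eq_zero_of_dirichlet_self {f : ℝ × ℝ → ℂ} {z : ℝ × ℝ} (hz : z ∈ interiorRegion)
    (h : (dirichlet f f z).re = 0) : fderiv ℝ f z = 0 := by
  have h1 := A₁₁_mul_dirichlet_self_re f z
  have h2 : 0 < 9 * p z * q z := mul_pos (mul_pos (by norm_num) hz.1) hz.2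
  have h3 := A₁₁_pos hz
  rw [h, mul_zero] at h1
  have s1 := sq_nonneg (A₁₁ z * (dx f z).re + A₁₂ z * (dy f z).re)
  have s2 := sq_nonneg (A₁₁ z * (dx f z).im + A₁₂ z * (dy f z).im)
  have s3 := mul_nonneg h2.le (add_nonneg (sq_nonneg (dy f z).re) (sq_nonneg (dy f z).im))
  have e3 : (dy f z).re ^ 2 + (dy f z).im ^ 2 = 0 := by
    have : 9 * p z * q z * ((dy f z).re ^ 2 + (dy f z).im ^ 2) = 0 := by linarith
    exact (mul_eq_zero.1 this).resolve_left h2.ne'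
  have r1 : (dy f z).re = 0 := by nlinarith [sq_nonneg (dy f z).re, sq_nonneg (dy f z).im]
  have r2 : (dy f z).im = 0 := by nlinarith [sq_nonneg (dy f z).re, sq_nonneg (dy f z).im]
  have e1 : (A₁₁ z * (dx f z).re + A₁₂ z * (dy f z).re) = 0 := by
    apply pow_eq_zero_iff (two_ne_zero) |>.1; linarith
  have e2 : (A₁₁ z * (dx f z).im + A₁₂ z * (dy f z).im) = 0 := by
    apply pow_eq_zero_iff (two_ne_zero) |>.1; linarith
  rw [r1, mul_zero, add_zero] at e1
  rw [r2, mul_zero, add_zero] at e2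
  have hx : fderiv ℝ f z (1, 0) = 0 :=
    Complex.ext ((mul_eq_zero.1 e1).resolve_left h3.ne') ((mul_eq_zero.1 e2).resolve_left h3.ne')
  have hy : fderiv ℝ f z (0, 1) = 0 := Complex.ext r1 r2
  refine ContinuousLinearMap.ext fun v => ?_
  have : v = v.1 • ((1, 0) : ℝ × ℝ) + v.2 • ((0, 1) : ℝ × ℝ) := by ext <;> simp
  rw [this, map_add, map_smul, map_smul, hx, hy]
  simp

/-- The open triangle is connected and dense in the closed one, so constancy extends to the boundary
by continuity. -/
lemma IsC2.eq_const_of_fderiv {f : ℝ × ℝ → ℂ} (hf : IsC2 f)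
    (h : ∀ z ∈ interiorRegion, fderiv ℝ f z = 0) : ∃ c : ℂ, ∀ z ∈ region, f z = c := by
  have hd : DifferentiableOn ℝ f interiorRegion := fun z hz =>
    ((hf z (interiorRegion_subset hz)).differentiableAt (by norm_num)).differentiableWithinAt
  obtain ⟨c, hc⟩ := isOpen_interiorRegion.exists_is_const_of_fderiv_eq_zero
    isPreconnected_interiorRegion hd h
  refine ⟨c, fun z hz => ?_⟩
  have hE : EqOn f (fun _ => c) interiorRegion := fun u hu => hc u hu
  exact hE.of_subset_closure hf.continuousOn continuousOn_const interiorRegion_subset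
    region_subset_closure hz

lemma L_eq_zero_of_const {α β : ℝ} {f : ℝ × ℝ → ℂ} (hf : IsC2 f) {c : ℂ}
    (hc : ∀ z ∈ region, f z = c) {z : ℝ × ℝ} (hz : z ∈ interiorRegion) : L α β f z = 0 := by
  have hd : ∀ u ∈ interiorRegion, fderiv ℝ f u = 0 := by
    intro u hu
    have : f =ᶠ[𝓝 u] fun _ => c := by
      filter_upwards [isOpen_interiorRegion.mem_nhds hu] with t ht
      exact hc t (interiorRegion_subset ht)
    rw [this.fderiv_eq]
    simp
  have h1 : dx f =ᶠ[𝓝 z] fun _ => 0 := by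
    filter_upwards [isOpen_interiorRegion.mem_nhds hz] with t ht
    simp [dx, hd t ht]
  have h2 : dy f =ᶠ[𝓝 z] fun _ => 0 := by
    filter_upwards [isOpen_interiorRegion.mem_nhds hz] with t ht
    simp [dy, hd t ht]
  rw [L_eq hz (hf z (interiorRegion_subset hz))]
  simp only [polyL, conormalP, conormalQ]
  rw [h1.self_of_nhds, h2.self_of_nhds]
  unfold dx dy at *
  rw [h1.fderiv_eq, h2.fderiv_eq]
  simp

lemma normConst_pos (α β : ℝ) : 0 < normConst α β := by
  unfold normConst
  split_ifs with h
  · refine one_div_pos.2 ?_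
    rw [setIntegral_pos_iff_support_of_nonneg_ae _ h]
    · refine (isOpen_interiorRegion.measure_pos volume interiorRegion_nonempty).trans_le
        (measure_mono fun z hz => ⟨(weight_pos hz).ne', interiorRegion_subset hz⟩)
    · exact (ae_restrict_iff' isClosed_region.measurableSet).2
        (Eventually.of_forall fun z hz => weight_nonneg hz)
  · exact one_pos

lemma continuousOn_dirichlet {f g : ℝ × ℝ → ℂ} (hf : IsC2 f) (hg : IsC2 g) :
    ContinuousOn (dirichlet f g) region := by
  have h1 := hg.continuousOn_dx
  have h2 := hg.continuousOn_dy
  have h3 : ContinuousOn (flux₁ f) region := fun z hz =>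
    (contDiffAt_flux₁ (hf z hz)).continuousAt.continuousWithinAt
  have h4 : ContinuousOn (flux₂ f) region := fun z hz =>
    (contDiffAt_flux₂ (hf z hz)).continuousAt.continuousWithinAt
  exact (h3.mul (Complex.continuous_conj.comp_continuousOn h1)).add
    (h4.mul (Complex.continuous_conj.comp_continuousOn h2))

/-- The truncated Dirichlet form is the integral of a nonnegative real function. -/
lemma truncated_dirichlet_eq (α β : ℝ) (n : ℕ) (f : ℝ × ℝ → ℂ) (z : ℝ × ℝ) :
    (cutoff n z : ℂ) * (dirichlet f f z * weight α β z) =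
      ((cutoff n z * ((dirichlet f f z).re * weight α β z) : ℝ) : ℂ) := by
  have : dirichlet f f z = ((dirichlet f f z).re : ℂ) :=
    Complex.ext rfl (by simp [dirichlet_self_im])
  conv_lhs => rw [this]
  push_cast
  ring

lemma tendsto_dirichlet_re {α β : ℝ} (hα : -1 < α) (hβ : -1 < β) {f : ℝ × ℝ → ℂ}
    (hf : InDomain α β f) :
    (∀ n, IntegrableOn
      (fun z => cutoff n z * ((dirichlet f f z).re * weight α β z)) region) ∧
    Tendsto (fun n => ((∫ z in region,
      cutoff n z * ((dirichlet f f z).re * weight α β z) : ℝ) : ℂ)) atTop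
      (𝓝 (∫ z in region, L α β f z * conj (f z) * (weight α β z : ℂ))) := by
  obtain ⟨h1, h2⟩ := tendsto_dirichlet hα hβ hf.isC2 hf
  simp only [truncated_dirichlet_eq] at h1 h2
  refine ⟨fun n => ?_, h2.congr fun n => integral_ofReal⟩
  have := (h1 n).re
  simpa [IntegrableOn] using this

lemma truncated_dirichlet_nonneg (α β : ℝ) (n : ℕ) (f : ℝ × ℝ → ℂ) :
    0 ≤ᵐ[volume.restrict region]
      fun z => cutoff n z * ((dirichlet f f z).re * weight α β z) := by
  filter_upwards [ae_region_mem_interiorRegion] with z hz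
  exact mul_nonneg (cutoff_nonneg _ _)
    (mul_nonneg (dirichlet_self_re_nonneg f hz) (weight_pos hz).le)

lemma integral_L_self_im_re {α β : ℝ} (hα : -1 < α) (hβ : -1 < β) {f : ℝ × ℝ → ℂ}
    (hf : InDomain α β f) :
    (∫ z in region, L α β f z * conj (f z) * (weight α β z : ℂ)).im = 0 ∧
    0 ≤ (∫ z in region, L α β f z * conj (f z) * (weight α β z : ℂ)).re := by
  have h := (tendsto_dirichlet_re hα hβ hf).2
  have him := (Complex.continuous_im.tendsto _).comp h
  have hre := (Complex.continuous_re.tendsto _).comp h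
  constructor
  · refine tendsto_nhds_unique him (tendsto_const_nhds.congr fun n => ?_)
    simp
  · refine ge_of_tendsto' hre fun n => ?_
    simp only [Function.comp_apply, Complex.ofReal_re]
    exact integral_nonneg_of_ae (truncated_dirichlet_nonneg α β n f)

/-- Green's formula gives only the limit of the truncated integrals, not integrability of the full
Dirichlet density. Fatou's lemma for these nonnegative integrands shows that the density vanishes
almost everywhere. -/
lemma eq_const_of_integral_L_self_eq_zero {α β : ℝ} (hα : -1 < α) (hβ : -1 < β)
    {f : ℝ × ℝ → ℂ} (hf : InDomain α β f)
    (h0 : ∫ z in region, L α β f z * conj (f z) * (weight α β z : ℂ) = 0) :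
    ∃ c : ℂ, ∀ z ∈ region, f z = c := by
  obtain ⟨hi, ht⟩ := tendsto_dirichlet_re hα hβ hf
  rw [h0] at ht
  have hre := (Complex.continuous_re.tendsto _).comp ht
  set F : ℝ × ℝ → ℝ := fun z => (dirichlet f f z).re * weight α β z with hF
  have hlim : Tendsto (fun n => ENNReal.ofReal (∫ z in region, cutoff n z * F z)) atTop (𝓝 0) := by
    have := (ENNReal.continuous_ofReal.tendsto _).comp hre
    simpa [Function.comp_def] using this
  have hfatou : ∫⁻ z in region, liminf (fun n => ENNReal.ofReal (cutoff n z * F z)) atTop ≤ 0 := by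
    refine (lintegral_liminf_le' fun n => (hi n).aestronglyMeasurable.aemeasurable.ennreal_ofReal
      ).trans (le_of_eq ?_)
    rw [← hlim.liminf_eq]
    congr 1
    ext n
    rw [ofReal_integral_eq_lintegral_ofReal (hi n) (truncated_dirichlet_nonneg α β n f)]
  have hFm : AEMeasurable (fun z => ENNReal.ofReal (F z)) (volume.restrict region) := by
    have h1 := (continuousOn_dirichlet hf.isC2 hf.isC2).aestronglyMeasurable (μ := volume)
      isClosed_region.measurableSet
    exact (h1.aemeasurable.re.mul (measurable_weight α β).aemeasurable).ennreal_ofReal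
  have hzero : ∫⁻ z in region, ENNReal.ofReal (F z) = 0 := by
    refine le_antisymm ((lintegral_mono_ae ?_).trans hfatou) zero_le
    filter_upwards [ae_region_mem_interiorRegion] with z hz
    refine le_of_eq (Tendsto.liminf_eq ?_).symm
    refine tendsto_const_nhds.congr' ?_
    filter_upwards [cutoff_eventually_eq_one hz] with n hn
    rw [hn, one_mul]
  rw [lintegral_eq_zero_iff' hFm] at hzero
  have hae : (fun z => (dirichlet f f z).re) =ᵐ[volume.restrict interiorRegion] fun _ => 0 := by
    rw [restrict_interiorRegion]
    filter_upwards [hzero, ae_region_mem_interiorRegion] with z hz hzi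
    have h1 : F z ≤ 0 := ENNReal.ofReal_eq_zero.1 hz
    have h2 := dirichlet_self_re_nonneg f hzi
    have h3 := weight_pos (α := α) (β := β) hzi
    exact le_antisymm (nonpos_of_mul_nonpos_left h1 h3) h2
  have hcont : ContinuousOn (fun z => (dirichlet f f z).re) interiorRegion :=
    Complex.continuous_re.comp_continuousOn
      ((continuousOn_dirichlet hf.isC2 hf.isC2).mono interiorRegion_subset)
  -- Continuity upgrades almost everywhere to everywhere on an open set.
  have hEq := Measure.eqOn_open_of_ae_eq hae isOpen_interiorRegion hcont continuousOn_const
  exact hf.isC2.eq_const_of_fderiv fun z hz => fderiv_eq_zero_of_dirichlet_self hz (hEq hz)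

/-! ### The case of finite mass. -/

lemma sqIntegrable_of_continuousOn {α β : ℝ} (hw : IntegrableOn (weight α β) region)
    {f : ℝ × ℝ → ℂ} (hf : ContinuousOn f region) : SqIntegrable α β f := by
  obtain ⟨C, hC⟩ := isCompact_region.exists_bound_of_continuousOn (hf.norm.pow 2)
  refine Integrable.mono' (hw.norm.const_mul C)
    (((hf.norm.pow 2).aestronglyMeasurable isClosed_region.measurableSet).mul
      hw.aestronglyMeasurable) ?_
  refine (ae_restrict_iff' isClosed_region.measurableSet).2 (Eventually.of_forall fun z hz => ?_)
  rw [norm_mul]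
  exact mul_le_mul_of_nonneg_right (hC z hz) (norm_nonneg _)

lemma inDomain_of_isC2 {α β : ℝ} (hw : IntegrableOn (weight α β) region) {f : ℝ × ℝ → ℂ}
    (hf : IsC2 f) : InDomain α β f := by
  refine ⟨hf, sqIntegrable_of_continuousOn hw hf.continuousOn, ?_⟩
  refine (sqIntegrable_of_continuousOn hw (hf.continuousOn_polyL α β).neg).congr ?_
  filter_upwards [hf.L_ae_eq α β] with z hz
  rw [hz, Pi.neg_apply]

end GTwoJacobi

end

/-! ### The theorem. -/

open GTwoJacobi
theorem theorem5p2 (α β : ℝ) (hα : -1 < α) (hβ : -1 < β) :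
    -- if the weight has finite mass, every function that is C² on the region is admissible
    (IntegrableOn (weight α β) region → ∀ f : ℝ × ℝ → ℂ, IsC2 f → InDomain α β f) ∧
    -- self-adjointness, with absolutely convergent integrals
    (∀ f g : ℝ × ℝ → ℂ, InDomain α β f → InDomain α β g →
      IntegrableOn (fun z => L α β f z * conj (g z) * (weight α β z : ℂ)) region ∧
      IntegrableOn (fun z => f z * conj (L α β g z) * (weight α β z : ℂ)) region ∧
      innerW α β (L α β f) g = innerW α β f (L α β g)) ∧
    -- positive definiteness, up to the constants (on which the operator vanishes)
    (∀ f : ℝ × ℝ → ℂ, InDomain α β f →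
      (innerW α β (L α β f) f).im = 0 ∧
      0 ≤ (innerW α β (L α β f) f).re ∧
      (innerW α β (L α β f) f = 0 ↔ ∃ c : ℂ, ∀ z ∈ region, f z = c)) := by
  refine ⟨fun hw f hf => inDomain_of_isC2 hw hf, fun f g hf hg => ⟨?_, ?_, ?_⟩, fun f hf => ?_⟩
  · exact hg.integrableOn_L_mul hα hβ hf.isC2
  · exact hf.integrableOn_mul_L hα hβ hg.isC2
  · rw [innerW, innerW, integral_L_mul_conj_comm hα hβ hf hg]
  · obtain ⟨him, hre⟩ := integral_L_self_im_re hα hβ hf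
    have hc := normConst_pos α β
    refine ⟨?_, ?_, fun h => ?_, ?_⟩
    · rw [innerW, Complex.im_ofReal_mul, him, mul_zero]
    · rw [innerW, Complex.re_ofReal_mul]
      exact mul_nonneg hc.le hre
    -- The normalization constant is positive even for infinite mass, where it is 1, so it can be
    -- cancelled.
    · refine eq_const_of_integral_L_self_eq_zero hα hβ hf ?_
      exact (mul_eq_zero.1 h).resolve_left (by exact_mod_cast hc.ne')
    · rintro ⟨c, hcst⟩
      rw [innerW]
      refine mul_eq_zero_of_right _ ?_
      rw [← integral_zero (ℝ × ℝ) ℂ (μ := volume.restrict region)]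
      refine integral_congr_ae ?_
      filter_upwards [ae_region_mem_interiorRegion] with z hz
      rw [L_eq_zero_of_const hf.isC2 hcst hz, zero_mul, zero_mul]
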